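/- Let $\mathbb D$ be the open unit disc. A radial weight is a function $\omega:\mathbb D\to[0,\infty)$ with $\omega(z)=\omega(|z|)$, $\int_0^1\omega(r)\,dr<\infty$ and $\widehat\omega(r)=\int_r^1\omega(t)\,dt>0$ for all $0\le r<1$; its moments are $\omega_k=\int_0^1 r^k\omega(r)\,dr$, $k=0,1,2,\dots$. The class $\mathcal D$ consists of the radial weights $\omega$ for which there are constants $C_1>1$, $C_2>1$ and $K>1$ such that $$\widehat\omega(r)\le C_1\,\widehat\omega\!\left(\tfrac{1+r}{2}\right)\quad\text{and}\quad \widehat\omega(r)\ge C_2\,\widehat\omega\!\left(1-\tfrac{1-r}{K}\right),\qquad 0\le r<1.$$ For $f$ analytic in $\mathbb D$ with Maclaurin series $f(z)=\sum_{k\ge0}\widehat f(k)z^k$, let $M_\infty(r,f)=\max_{|z|=r}|f(z)|$ and $J^p_\omega(f)=\int_0^1M_\infty(r,f)^p\,\omega(r)\,dr\in[0,\infty]$. A function is univalent if it is analytic and injective in $\mathbb D$; it is convex if it is univalent and its image of $\mathbb D$ is a convex set; an analytic function $f$ in $\mathbb D$ is close-to-convex if $\operatorname{Re}(f'/g')>0$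 in $\mathbb D$ for some convex function $g$ (no normalization of $f$ or $g$ is required). **Theorem.** Let $\omega\in\mathcal D$ and $1\le p\le 2$. Then there is a constant $C=C(p,\omega)\ge 1$ such that, for every univalent function $f$ in $\mathbb D$, $$C^{-1}\sum_{k=0}^\infty|\widehat f(k)|^p(k+1)^{p-1}\omega_k\;\le\;J^p_\omega(f)\;\le\;C\sum_{k=0}^\infty|\widehat f(k)|^p(k+1)^{p-1}\omega_k ,$$ both sides being allowed to be infinite (so one is finite if and only if the other is). Moreover, for every $1\le p<\infty$ and $\omega\in\mathcal D$ there is a constant $C=C(p,\omega)\ge1$ such that the same two inequalities hold for every close-to-convex function $f$ in $\mathbb D$. -/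

import Mathlib

open scoped ENNReal NNReal

noncomputable section

namespace ConformalWeights

/-- The open unit disc. -/
def disc : Set ℂ := Metric.ball 0 1

/-- A radial weight on the unit disc: a nonnegative function on the disc depending only on the
modulus, integrable along the radius `(0, 1)`, all of whose tail integrals are strictly positive.
Values outside the disc play no role. -/
structure IsRadialWeight (ω : ℂ → ℝ) : Prop where
  nonneg : ∀ z ∈ disc, 0 ≤ ω z
  radial : ∀ z ∈ disc, ω z = ω (‖z‖ : ℂ)
  integrable : MeasureTheory.IntegrableOn (fun r : ℝ => ω (r : ℂ)) (Set.Ioo 0 1)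
  tail_pos : ∀ r : ℝ, 0 ≤ r → r < 1 → 0 < ∫ t in Set.Ioo r 1, ω (t : ℂ)

/-- The tail integral `∫_r^1 ω(t) dt`. -/
def tail (ω : ℂ → ℝ) (r : ℝ) : ℝ := ∫ t in Set.Ioo r 1, ω (t : ℂ)

/-- The moment `ω_x = ∫_0^1 r^x ω(r) dr`. -/
def moment (ω : ℂ → ℝ) (x : ℝ) : ℝ := ∫ r in Set.Ioo (0 : ℝ) 1, r ^ x * ω (r : ℂ)

/-- Upper doubling: `tail ω r ≤ C * tail ω ((1 + r) / 2)` for some `C > 1`. -/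
def IsUpperDoubling (ω : ℂ → ℝ) : Prop :=
  ∃ C : ℝ, 1 < C ∧ ∀ r : ℝ, 0 ≤ r → r < 1 → tail ω r ≤ C * tail ω ((1 + r) / 2)

/-- Lower (reverse) doubling: `C * tail ω (1 - (1 - r) / K) ≤ tail ω r` for some `K, C > 1`. -/
def IsLowerDoubling (ω : ℂ → ℝ) : Prop :=
  ∃ K C : ℝ, 1 < K ∧ 1 < C ∧
    ∀ r : ℝ, 0 ≤ r → r < 1 → C * tail ω (1 - (1 - r) / K) ≤ tail ω r

/-- The class `𝓓` of radial weights that satisfy both doubling conditions. -/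
structure IsDoublingWeight (ω : ℂ → ℝ) : Prop where
  weight : IsRadialWeight ω
  upper : IsUpperDoubling ω
  lower : IsLowerDoubling ω

/-- The maximum modulus `M_∞(r, f)` of `f` on the circle `|z| = r`. -/
def maxModulus (r : ℝ) (f : ℂ → ℂ) : ℝ := sSup ((fun z => ‖f z‖) '' Metric.sphere 0 r)

/-- The quantity `J_ω^p(f) = ∫_0^1 M_∞(r, f)^p ω(r) dr`, possibly infinite. -/
def J (p : ℝ) (ω : ℂ → ℝ) (f : ℂ → ℂ) : ℝ≥0∞ :=
  ∫⁻ r in Set.Ioo (0 : ℝ) 1, ENNReal.ofReal (maxModulus r f ^ p * ω (r : ℂ))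

/-- The `k`-th Maclaurin coefficient of `f`. -/
def coeff (f : ℂ → ℂ) (k : ℕ) : ℂ := iteratedDeriv k f 0 / (k.factorial : ℂ)

/-- The sum `∑_{k ≥ 0} |coeff f k|^p (k + 1)^(p - 1) ω_k`, possibly infinite. -/
def coeffSum (p : ℝ) (ω : ℂ → ℝ) (f : ℂ → ℂ) : ℝ≥0∞ :=
  ∑' k : ℕ, ENNReal.ofReal (‖coeff f k‖ ^ p * ((k : ℝ) + 1) ^ (p - 1) * moment ω (k : ℝ))

/-- The class of univalent functions: analytic and injective on the unit disc. -/
def Univalent : Set (ℂ → ℂ) := {f | DifferentiableOn ℂ f disc ∧ Set.InjOn f disc}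

/-- A convex function: a univalent function whose image of the unit disc is convex. -/
def IsConvexFunction (g : ℂ → ℂ) : Prop := g ∈ Univalent ∧ Convex ℝ (g '' disc)

/-- The close-to-convex functions: `f` is analytic on the disc and `Re (f' / g') > 0` there for
some (not necessarily normalized) convex function `g`. -/
def CloseToConvex : Set (ℂ → ℂ) :=
  {f | DifferentiableOn ℂ f disc ∧
    ∃ g, IsConvexFunction g ∧ ∀ z ∈ disc, 0 < (deriv f z / deriv g z).re}

/-- `A ≍ B` on `S`: each is bounded by a finite positive constant multiple of the other on `S`. -/
def ComparableOn (S : Set (ℂ → ℂ)) (A B : (ℂ → ℂ) → ℝ≥0∞) : Prop :=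
  (∃ C : ℝ≥0, 0 < C ∧ ∀ f ∈ S, A f ≤ C * B f) ∧ (∃ C : ℝ≥0, 0 < C ∧ ∀ f ∈ S, B f ≤ C * A f)

end ConformalWeights

end

open scoped ENNReal NNReal ComplexConjugate

noncomputable section

namespace ConformalWeights

open MeasureTheory Set Metric

/-! ### Doubling weights along a dyadic sequence of radii -/

/-! Both inequalities reduce to dyadic estimates. For `2 ^ n ≤ k < 2 ^ (n + 1)` the moment `ω_k` is
comparable to the tail at `1 - 2⁻ⁿ`: upper doubling lets tails grow at most geometrically towards
the origin, where `r ^ k` is doubly exponentially small, and lower doubling makes them decay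
geometrically towards the boundary.

The bound of `J` by the coefficient sum holds for every analytic function and every `p ≥ 1`.
Hölder's inequality is applied to `M_∞(r, f) ≤ ∑ |a_k| r ^ k` with weights `(k + 1) ^ (δ - 1) * r ^
k`, whose sum is `O((1 - r) ^ (-δ))`. For small `δ` the resulting power of `1 - r` is absorbed by
the geometric decay of the tails (`exists_lintegral_rpow_mul_pow_le`, `exists_J_le`).

The converse needs only that each block sum of `|a_k| ^ p * (k + 1) ^ (p - 1)` is bounded by a
multiple of the `p`-th power of the maximum modulus two dyadic steps further out; summing against
tails then gives `J` (`exists_tsum_mul_tail_le`, `exists_coeffSum_le`). For univalent `f` the area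
theorem controls `∑ k |a_k| ^ 2 R ^ (2 k)`, and Hölder's inequality passes from exponent `2` to `p`,
which is where `p ≤ 2` enters. For close-to-convex `f` the stronger pointwise bound `k |a_k| ≤ C
M_∞` holds, so every `p ≥ 1` is allowed. It comes from an `L¹` estimate of `f''`. With `f' = g' h`,
`g` convex and `Re h > 0`, one has `f'' = f' g'' / g' + g' h'`. The first term is handled by square
means of `f'` (area) and of `z g'' / g'` (real part at least `-1`). The second is handled by
Schwarz–Pick for `h` together with an integration by parts bounding the mean of `|z g'| Re h` by
`M_∞(r, f)`. -/

/-- The dyadic radii `1 - 2⁻ⁿ`. -/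
def dyad (n : ℕ) : ℝ := 1 - (1 / 2) ^ n

lemma dyad_zero : dyad 0 = 0 := by simp [dyad]

lemma dyad_lt_one (n : ℕ) : dyad n < 1 := by
  unfold dyad; have : (0 : ℝ) < (1 / 2) ^ n := by positivity
  linarith

lemma dyad_mono : Monotone dyad := by
  intro a b h
  unfold dyad
  have : ((1 : ℝ) / 2) ^ b ≤ (1 / 2) ^ a :=
    pow_le_pow_of_le_one (by norm_num) (by norm_num) h
  linarith

lemma dyad_nonneg (n : ℕ) : 0 ≤ dyad n := dyad_zero ▸ dyad_mono (Nat.zero_le n)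

lemma one_add_dyad_div_two (n : ℕ) : (1 + dyad n) / 2 = dyad (n + 1) := by
  unfold dyad; rw [pow_succ]; ring

lemma half_le_dyad_succ (n : ℕ) : 1 / 2 ≤ dyad (n + 1) := by
  have := dyad_mono (Nat.succ_le_succ (Nat.zero_le n))
  have h1 : dyad 1 = 1 / 2 := by norm_num [dyad]
  rw [← h1]; exact this

/-- The numbers `(1 - 2⁻ᵐ) ^ 2 ^ m` increase from the value `1 / 4` at `m = 1`, because `1 - 2 x ≤
(1 - x) ^ 2`. -/
lemma dyad_succ_pow_two_pow (n : ℕ) : 1 / 4 ≤ dyad (n + 1) ^ 2 ^ (n + 1) := by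
  induction n with
  | zero => norm_num [dyad]
  | succ n ih =>
    refine ih.trans ?_
    rw [pow_succ 2 (n + 1), mul_comm, pow_mul]
    refine pow_le_pow_left₀ (dyad_nonneg _) ?_ _
    unfold dyad
    have h : ((1 : ℝ) / 2) ^ (n + 1) = 2 * (1 / 2) ^ (n + 1 + 1) := by rw [pow_succ _ (n + 1)]; ring
    rw [h]
    nlinarith [sq_nonneg (((1 : ℝ) / 2) ^ (n + 1 + 1))]

/-- From `1 - x ≤ exp (-x)`. This doubly exponential decay beats the geometric growth of the tails
towards the origin. -/
lemma dyad_succ_pow_le_exp (j i : ℕ) :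
    dyad (j + 1) ^ 2 ^ (i + j + 1) ≤ Real.exp (-2 ^ i) := by
  have h1 : dyad (j + 1) ≤ Real.exp (-(1 / 2) ^ (j + 1)) := by
    have := Real.add_one_le_exp (-((1 : ℝ) / 2) ^ (j + 1))
    unfold dyad; linarith
  calc dyad (j + 1) ^ 2 ^ (i + j + 1) ≤ Real.exp (-(1 / 2) ^ (j + 1)) ^ 2 ^ (i + j + 1) :=
        pow_le_pow_left₀ (dyad_nonneg _) h1 _
    _ = Real.exp (-2 ^ i) := by
        rw [← Real.exp_nat_mul]
        congr 1
        push_cast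
        rw [add_assoc i, pow_add, one_div, inv_pow]
        field_simp

lemma iUnion_Ico_dyad : ⋃ n, Ico (dyad n) (dyad (n + 1)) = Ico 0 1 := by
  ext r
  simp only [mem_iUnion, mem_Ico]
  constructor
  · rintro ⟨n, h1, h2⟩
    exact ⟨(dyad_nonneg n).trans h1, h2.trans (dyad_lt_one _)⟩
  · rintro ⟨h1, h2⟩
    have hex : ∃ n, r < dyad n := by
      obtain ⟨n, hn⟩ := exists_pow_lt_of_lt_one (sub_pos.2 h2) (by norm_num : (1 / 2 : ℝ) < 1)
      exact ⟨n, by unfold dyad; linarith⟩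
    classical
    have h0 : Nat.find hex ≠ 0 := by
      intro h
      have := Nat.find_spec hex
      rw [h, dyad_zero] at this
      linarith
    obtain ⟨k, hk⟩ := Nat.exists_eq_succ_of_ne_zero h0
    refine ⟨k, ?_, ?_⟩
    · by_contra hlt
      exact Nat.find_min hex (m := k) (by omega) (not_le.1 hlt)
    · have := Nat.find_spec hex
      rwa [hk] at this

lemma lintegral_Ioo_eq_tsum_dyad (F : ℝ → ℝ≥0∞) :
    ∫⁻ r in Ioo (0 : ℝ) 1, F r = ∑' n, ∫⁻ r in Ico (dyad n) (dyad (n + 1)), F r := by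
  rw [setLIntegral_congr Ioo_ae_eq_Ico, ← iUnion_Ico_dyad, lintegral_iUnion]
  · exact fun n => measurableSet_Ico
  · exact dyad_mono.pairwise_disjoint_on_Ico_succ

/-! ### Tails and moments of doubling weights -/

section Weight

variable {ω : ℂ → ℝ}

lemma IsRadialWeight.nonneg_of_mem (hω : IsRadialWeight ω) {r : ℝ} (h0 : 0 ≤ r) (h1 : r < 1) :
    0 ≤ ω (r : ℂ) :=
  hω.nonneg _ (by simp [disc, abs_of_nonneg h0, h1])

lemma IsRadialWeight.integrableOn_Ioo (hω : IsRadialWeight ω) {r s : ℝ} (h0 : 0 ≤ r) (hs : s ≤ 1) :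
    IntegrableOn (fun t : ℝ => ω (t : ℂ)) (Ioo r s) :=
  hω.integrable.mono_set (Ioo_subset_Ioo h0 hs)

lemma IsRadialWeight.ofReal_setIntegral (hω : IsRadialWeight ω) {r s : ℝ} (h0 : 0 ≤ r)
    (hs : s ≤ 1) :
    ENNReal.ofReal (∫ t in Ioo r s, ω (t : ℂ)) = ∫⁻ t in Ioo r s, ENNReal.ofReal (ω (t : ℂ)) :=
  ofReal_integral_eq_lintegral_ofReal (hω.integrableOn_Ioo h0 hs)
    ((ae_restrict_iff' measurableSet_Ioo).2 (ae_of_all _ fun _ ht =>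
      hω.nonneg_of_mem (h0.trans ht.1.le) (ht.2.trans_le hs)))

lemma IsRadialWeight.ofReal_tail (hω : IsRadialWeight ω) {r : ℝ} (h0 : 0 ≤ r) :
    ENNReal.ofReal (tail ω r) = ∫⁻ t in Ioo r 1, ENNReal.ofReal (ω (t : ℂ)) :=
  hω.ofReal_setIntegral h0 le_rfl

lemma IsRadialWeight.tail_nonneg (hω : IsRadialWeight ω) {r : ℝ} (h0 : 0 ≤ r) : 0 ≤ tail ω r :=
  setIntegral_nonneg measurableSet_Ioo fun _ ht => hω.nonneg_of_mem (h0.trans ht.1.le) ht.2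

lemma IsRadialWeight.tail_anti (hω : IsRadialWeight ω) {r s : ℝ} (h0 : 0 ≤ r) (h : r ≤ s) :
    tail ω s ≤ tail ω r := by
  rw [← ENNReal.ofReal_le_ofReal_iff (hω.tail_nonneg h0), hω.ofReal_tail h0,
    hω.ofReal_tail (h0.trans h)]
  exact lintegral_mono_set (Ioo_subset_Ioo_left h)

lemma IsRadialWeight.ofReal_moment (hω : IsRadialWeight ω) (k : ℕ) :
    ENNReal.ofReal (moment ω k) =
      ∫⁻ r in Ioo (0 : ℝ) 1, ENNReal.ofReal (r ^ k) * ENNReal.ofReal (ω (r : ℂ)) := by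
  unfold moment
  simp only [Real.rpow_natCast]
  rw [ofReal_integral_eq_lintegral_ofReal]
  · refine setLIntegral_congr_fun measurableSet_Ioo fun r hr => ?_
    exact ENNReal.ofReal_mul (pow_nonneg hr.1.le _)
  · refine Integrable.mono hω.integrable
      (((continuous_pow k).aestronglyMeasurable).mul hω.integrable.aestronglyMeasurable) ?_
    refine (ae_restrict_iff' measurableSet_Ioo).2 (ae_of_all _ fun r hr => ?_)
    rw [norm_mul]
    refine mul_le_of_le_one_left (norm_nonneg _) ?_
    rw [norm_pow, Real.norm_eq_abs, abs_of_pos hr.1]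
    exact pow_le_one₀ hr.1.le hr.2.le
  · refine (ae_restrict_iff' measurableSet_Ioo).2 (ae_of_all _ fun r hr => ?_)
    exact mul_nonneg (pow_nonneg hr.1.le _) (hω.nonneg_of_mem hr.1.le hr.2)

/-- Geometric growth of the tails towards the origin. -/
lemma IsDoublingWeight.exists_tail_le_pow_mul (hω : IsDoublingWeight ω) :
    ∃ C : ℝ, 1 < C ∧ ∀ n j, tail ω (dyad n) ≤ C ^ j * tail ω (dyad (n + j)) := by
  obtain ⟨C, hC, h⟩ := hω.upper
  refine ⟨C, hC, fun n j => ?_⟩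
  induction j with
  | zero => simp
  | succ j ih =>
    refine ih.trans ?_
    have := h (dyad (n + j)) (dyad_nonneg _) (dyad_lt_one _)
    rw [one_add_dyad_div_two] at this
    rw [pow_succ, mul_assoc]
    gcongr
    exact this

/-- Once `2 ^ m > K`, the radius `dyad (n + m)` lies beyond `1 - (1 - dyad n) / K`, so lower
doubling passes to dyadic radii. -/
lemma IsDoublingWeight.exists_mul_tail_le (hω : IsDoublingWeight ω) :
    ∃ m : ℕ, ∃ C : ℝ, 1 < C ∧ ∀ n, C * tail ω (dyad (n + m)) ≤ tail ω (dyad n) := by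
  obtain ⟨K, C, hK, hC, h⟩ := hω.lower
  obtain ⟨m, hm⟩ := pow_unbounded_of_one_lt K (one_lt_two : (1 : ℝ) < 2)
  refine ⟨m, C, hC, fun n => ?_⟩
  refine le_trans ?_ (h _ (dyad_nonneg n) (dyad_lt_one n))
  have h1 : 0 < 1 - dyad n := by linarith [dyad_lt_one n]
  have h2 : 1 - dyad n ≤ 1 := by linarith [dyad_nonneg n]
  have hx : (1 - dyad n) / K ≤ 1 := (div_le_one (by linarith)).2 (by linarith)
  gcongr
  refine hω.weight.tail_anti (by linarith) ?_
  have h3 : (1 : ℝ) / 2 ^ m ≤ 1 / K := one_div_le_one_div_of_le (by linarith) hm.le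
  have h4 : 1 - dyad (n + m) = (1 - dyad n) * (1 / 2 ^ m) := by
    unfold dyad; rw [pow_add, one_div_pow _ m]; ring
  have h5 : (1 - dyad n) * (1 / 2 ^ m) ≤ (1 - dyad n) * (1 / K) := by gcongr
  rw [div_eq_mul_one_div (1 - dyad n) K]
  linarith

/-- Geometric decay of the tails towards the boundary. -/
lemma IsDoublingWeight.exists_tail_le_geometric (hω : IsDoublingWeight ω) :
    ∃ q A : ℝ, 0 < q ∧ q < 1 ∧ 0 < A ∧
      ∀ n j, tail ω (dyad (n + j)) ≤ A * q ^ j * tail ω (dyad n) := by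
  obtain ⟨m, C, hC, h⟩ := hω.exists_mul_tail_le
  have hm : m ≠ 0 := by
    rintro rfl
    have h1 := h 0
    have h2 : 0 < tail ω (dyad 0) := hω.weight.tail_pos _ (dyad_nonneg 0) (dyad_lt_one 0)
    simp only [add_zero] at h1
    nlinarith
  have hC0 : 0 < C := by linarith
  -- The gain `C⁻¹` per `m` steps is spread evenly over single steps; the prefactor `C` later pays
  -- for the remainder of `j` modulo `m`.
  set q : ℝ := (C⁻¹) ^ ((m : ℝ)⁻¹) with hq
  have hq0 : 0 < q := Real.rpow_pos_of_pos (inv_pos.2 hC0) _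
  have hqm : q ^ m = C⁻¹ := Real.rpow_inv_natCast_pow (inv_nonneg.2 hC0.le) hm
  have hq1 : q < 1 := by
    refine Real.rpow_lt_one (inv_nonneg.2 hC0.le) (inv_lt_one_of_one_lt₀ hC) ?_
    positivity
  have hstep : ∀ n i, tail ω (dyad (n + m * i)) ≤ C⁻¹ ^ i * tail ω (dyad n) := by
    intro n i
    induction i with
    | zero => simp
    | succ i ih =>
      have h1 := h (n + m * i)
      rw [mul_add, mul_one, ← add_assoc]
      have h2 : tail ω (dyad (n + m * i + m)) ≤ C⁻¹ * tail ω (dyad (n + m * i)) := by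
        rw [inv_mul_eq_div, le_div_iff₀ hC0, mul_comm]; exact h1
      refine h2.trans ?_
      rw [pow_succ, mul_comm (C⁻¹ ^ i), mul_assoc]
      gcongr
  refine ⟨q, C, hq0, hq1, hC0, fun n j => ?_⟩
  have hT := hω.weight.tail_nonneg (dyad_nonneg n)
  have h1 : tail ω (dyad (n + j)) ≤ tail ω (dyad (n + m * (j / m))) :=
    hω.weight.tail_anti (dyad_nonneg _) (dyad_mono (by have := Nat.mul_div_le j m; omega))
  refine (h1.trans (hstep n (j / m))).trans ?_
  gcongr
  have h2 : q ^ (m * (j / m + 1)) ≤ q ^ j :=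
    pow_le_pow_of_le_one hq0.le hq1.le (by
      have := Nat.lt_mul_div_succ j (Nat.pos_of_ne_zero hm); omega)
  rw [pow_mul, hqm, pow_succ] at h2
  calc C⁻¹ ^ (j / m) = C * (C⁻¹ ^ (j / m) * C⁻¹) := by field_simp
    _ ≤ C * q ^ j := by gcongr

/-- Moments dominate the tails from below. -/
lemma IsDoublingWeight.exists_tail_le_moment (hω : IsDoublingWeight ω) :
    ∃ C : ℝ≥0∞, C ≠ ⊤ ∧ ∀ n k : ℕ, k + 1 ≤ 2 ^ (n + 1) →
      ENNReal.ofReal (tail ω (dyad n)) ≤ C * ENNReal.ofReal (moment ω k) := by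
  obtain ⟨C, hC, h⟩ := hω.exists_tail_le_pow_mul
  have hC0 : 0 < C := by linarith
  -- The `4` comes from `r ^ k ≥ 1 / 4` beyond `dyad (n + 1)`, the `C` from moving the tail one
  -- dyadic step outward.
  refine ⟨ENNReal.ofReal (4 * C), ENNReal.ofReal_ne_top, fun n k hk => ?_⟩
  have key : ENNReal.ofReal (1 / 4) * ENNReal.ofReal (tail ω (dyad (n + 1))) ≤
      ENNReal.ofReal (moment ω k) := by
    rw [hω.weight.ofReal_moment, hω.weight.ofReal_tail (dyad_nonneg _),
      ← lintegral_const_mul' _ _ ENNReal.ofReal_ne_top]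
    refine (lintegral_mono_ae ?_).trans (lintegral_mono_set (Ioo_subset_Ioo_left (dyad_nonneg (n + 1))))
    refine (ae_restrict_iff' measurableSet_Ioo).2 (ae_of_all _ fun r hr => ?_)
    gcongr
    calc 1 / 4 ≤ dyad (n + 1) ^ 2 ^ (n + 1) := dyad_succ_pow_two_pow n
      _ ≤ dyad (n + 1) ^ k :=
        pow_le_pow_of_le_one (dyad_nonneg _) (dyad_lt_one _).le (by omega)
      _ ≤ r ^ k := pow_le_pow_left₀ (dyad_nonneg _) hr.1.le _
  have h1 := h n 1
  rw [pow_one] at h1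
  calc ENNReal.ofReal (tail ω (dyad n)) ≤ ENNReal.ofReal (4 * C * (1 / 4 * tail ω (dyad (n + 1)))) :=
        ENNReal.ofReal_le_ofReal (by linarith)
    _ = ENNReal.ofReal (4 * C) * (ENNReal.ofReal (1 / 4) * ENNReal.ofReal (tail ω (dyad (n + 1)))) := by
        rw [ENNReal.ofReal_mul (p := 4 * C) (by positivity),
          ENNReal.ofReal_mul (p := 1 / 4) (by positivity)]
    _ ≤ ENNReal.ofReal (4 * C) * ENNReal.ofReal (moment ω k) := by gcongr

lemma IsRadialWeight.ofReal_tail_Ico (hω : IsRadialWeight ω) (n : ℕ) :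
    ENNReal.ofReal (tail ω (dyad n)) = ∫⁻ t in Ico (dyad n) 1, ENNReal.ofReal (ω (t : ℂ)) := by
  rw [hω.ofReal_tail (dyad_nonneg n), setLIntegral_congr Ioo_ae_eq_Ico]

lemma summable_pow_mul_exp_neg_two_pow {C : ℝ} (hC : 0 < C) :
    Summable fun i : ℕ => C ^ (i + 1) * Real.exp (-2 ^ i) := by
  refine summable_of_ratio_test_tendsto_lt_one (l := 0) one_pos
    (Filter.Eventually.of_forall fun n => by positivity) ?_
  have h : ∀ n : ℕ, ‖C ^ (n + 1 + 1) * Real.exp (-2 ^ (n + 1))‖ / ‖C ^ (n + 1) * Real.exp (-2 ^ n)‖ =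
      C * Real.exp (-2 ^ n) := by
    intro n
    rw [Real.norm_of_nonneg (by positivity), Real.norm_of_nonneg (by positivity),
      div_eq_iff (by positivity)]
    have : Real.exp (-2 ^ (n + 1)) = Real.exp (-2 ^ n) * Real.exp (-2 ^ n) := by
      rw [← Real.exp_add]; congr 1; ring
    rw [this]; ring
  simp only [h]
  have h2 : Filter.Tendsto (fun n : ℕ => Real.exp (-(2 : ℝ) ^ n)) Filter.atTop (nhds 0) :=
    Real.tendsto_exp_neg_atTop_nhds_zero.comp (tendsto_pow_atTop_atTop_of_one_lt one_lt_two)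
  simpa using h2.const_mul C

/-- A moment estimate for a doubling weight that tolerates a small negative power of `1 - r`. -/
lemma IsDoublingWeight.exists_lintegral_rpow_mul_pow_le (hω : IsDoublingWeight ω) :
    ∃ η₀ : ℝ, 0 < η₀ ∧ η₀ ≤ 1 ∧ ∃ D : ℝ≥0∞, D ≠ ⊤ ∧ ∀ η : ℝ, 0 ≤ η → η ≤ η₀ → ∀ n k : ℕ,
      2 ^ n ≤ k + 1 →
      ∫⁻ r in Ioo (0 : ℝ) 1, ENNReal.ofReal ((1 - r) ^ (-η) * r ^ k) * ENNReal.ofReal (ω (r : ℂ)) ≤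
        D * ENNReal.ofReal ((2 ^ n) ^ η * tail ω (dyad n)) := by
  obtain ⟨C, hC, hup⟩ := hω.exists_tail_le_pow_mul
  obtain ⟨q, A, hq0, hq1, hA, hlow⟩ := hω.exists_tail_le_geometric
  have hC0 : 0 < C := by linarith
  -- Over one dyadic step `(1 - r) ^ (-η)` grows by at most `2 ^ η₀` and the tail decays by `q`;
  -- their product must stay below `1`.
  obtain ⟨η₀, hη0, hη1, hs⟩ : ∃ η₀ : ℝ, 0 < η₀ ∧ η₀ ≤ 1 ∧ (2 : ℝ) ^ η₀ * q < 1 := by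
    have hc : Filter.Tendsto (fun η : ℝ => (2 : ℝ) ^ η * q) (nhdsWithin 0 (Ioi 0)) (nhds q) := by
      have : Continuous fun η : ℝ => (2 : ℝ) ^ η * q := by
        have := Real.continuous_const_rpow (a := (2 : ℝ)) two_ne_zero
        fun_prop
      have h := this.tendsto 0
      simp only [Real.rpow_zero, one_mul] at h
      exact h.mono_left nhdsWithin_le_nhds
    have h1 := hc.eventually_lt_const hq1
    have h2 : ∀ᶠ η : ℝ in nhdsWithin 0 (Ioi 0), η ∈ Ioo (0 : ℝ) 1 := Ioo_mem_nhdsGT one_pos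
    obtain ⟨η, h3, h4⟩ := (h1.and h2).exists
    exact ⟨η, h4.1, h4.2.le, h3⟩
  set s : ℝ := 2 ^ η₀ * q with hsdef
  have hs0 : 0 ≤ s := by positivity
  -- `b₁` majorizes the annuli inside `dyad n`, counted inward, and `b₂` those outside, counted
  -- outward. The `2` in `b₁` comes from replacing exponent `k + 1` by `k` at radii at least `1 /
  -- 2`, the `2` in `b₂` from `2 ^ η ≤ 2`.
  set b₁ : ℕ → ℝ := fun i => 2 * (C ^ (i + 1) * Real.exp (-2 ^ i)) with hb₁
  set b₂ : ℕ → ℝ := fun i => 2 * A * s ^ i with hb₂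
  have hb₁0 : ∀ i, 0 ≤ b₁ i := fun i => by positivity
  have hb₂0 : ∀ i, 0 ≤ b₂ i := fun i => by positivity
  have hsum₁ : Summable b₁ := (summable_pow_mul_exp_neg_two_pow hC0).mul_left 2
  have hsum₂ : Summable b₂ := (summable_geometric_of_lt_one hs0 hs).mul_left _
  refine ⟨η₀, hη0, hη1, ∑' i, ENNReal.ofReal (b₁ i) + ∑' i, ENNReal.ofReal (b₂ i),
    ENNReal.add_ne_top.2 ⟨hsum₁.tsum_ofReal_ne_top, hsum₂.tsum_ofReal_ne_top⟩, ?_⟩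
  intro η h0 hη n k hk
  set X : ℝ≥0∞ := ENNReal.ofReal ((2 ^ n) ^ η * tail ω (dyad n)) with hX
  set F : ℕ → ℝ≥0∞ := fun j => ∫⁻ r in Ico (dyad j) (dyad (j + 1)),
    ENNReal.ofReal ((1 - r) ^ (-η) * r ^ k) * ENNReal.ofReal (ω (r : ℂ)) with hF
  have hFj : ∀ j, F j ≤ ENNReal.ofReal ((2 ^ (j + 1)) ^ η * dyad (j + 1) ^ k * tail ω (dyad j)) := by
    intro j
    rw [ENNReal.ofReal_mul (by have := dyad_nonneg (j + 1); positivity),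
      hω.weight.ofReal_tail_Ico, ← lintegral_const_mul' _ _ ENNReal.ofReal_ne_top]
    refine (lintegral_mono_ae ?_).trans
      (lintegral_mono_set (Ico_subset_Ico_right (dyad_lt_one (j + 1)).le))
    refine (ae_restrict_iff' measurableSet_Ico).2 (ae_of_all _ fun r hr => ?_)
    have hr0 : 0 ≤ r := (dyad_nonneg j).trans hr.1
    have h1 : ((1 : ℝ) / 2) ^ (j + 1) ≤ 1 - r := by have := hr.2; unfold dyad at this; linarith
    gcongr ENNReal.ofReal ?_ * _
    refine mul_le_mul ?_ (pow_le_pow_left₀ hr0 hr.2.le _) (pow_nonneg hr0 _) (by positivity)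
    calc (1 - r) ^ (-η) ≤ (((1 : ℝ) / 2) ^ (j + 1)) ^ (-η) :=
          Real.rpow_le_rpow_of_nonpos (by positivity) h1 (by linarith)
      _ = (2 ^ (j + 1)) ^ η := by
          rw [Real.rpow_neg (by positivity), ← Real.inv_rpow (by positivity), one_div, inv_pow, inv_inv]
  have htail : ∀ m, 0 ≤ tail ω (dyad m) := fun m => hω.weight.tail_nonneg (dyad_nonneg m)
  have hhigh : ∀ i, F (i + n) ≤ X * ENNReal.ofReal (b₂ i) := by
    intro i
    refine (hFj _).trans ?_
    rw [hX, ← ENNReal.ofReal_mul (by have := htail n; positivity)]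
    refine ENNReal.ofReal_le_ofReal ?_
    have h1 : tail ω (dyad (i + n)) ≤ A * q ^ i * tail ω (dyad n) := by
      rw [add_comm]; exact hlow n i
    have h2 : dyad (i + n + 1) ^ k ≤ 1 := pow_le_one₀ (dyad_nonneg _) (dyad_lt_one _).le
    have h3 : ((2 : ℝ) ^ (i + n + 1)) ^ η ≤ (2 ^ n) ^ η * (2 * (2 ^ η₀) ^ i) := by
      rw [show i + n + 1 = n + (1 + i) by ring, pow_add, Real.mul_rpow (by positivity) (by positivity),
        pow_add, Real.mul_rpow (by positivity) (by positivity)]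
      have e1 : ((2 : ℝ) ^ 1) ^ η ≤ 2 := by
        rw [pow_one]
        exact (Real.rpow_le_rpow_of_exponent_le one_le_two (hη.trans hη1)).trans (by simp)
      have e2 : ((2 : ℝ) ^ i) ^ η ≤ (2 ^ η₀) ^ i := by
        rw [← Real.rpow_natCast, ← Real.rpow_natCast, ← Real.rpow_mul (by norm_num),
          ← Real.rpow_mul (by norm_num)]
        refine Real.rpow_le_rpow_of_exponent_le one_le_two ?_
        rw [mul_comm]; gcongr
      gcongr
    calc ((2 : ℝ) ^ (i + n + 1)) ^ η * dyad (i + n + 1) ^ k * tail ω (dyad (i + n))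
        ≤ ((2 ^ n) ^ η * (2 * (2 ^ η₀) ^ i)) * 1 * (A * q ^ i * tail ω (dyad n)) := by
          have := htail (i + n)
          have := pow_nonneg (dyad_nonneg (i + n + 1)) k
          gcongr
      _ = (2 ^ n) ^ η * tail ω (dyad n) * b₂ i := by
          rw [hb₂, hsdef]; simp only [mul_pow]; ring
  have hlow' : ∀ i, i < n → F (n - 1 - i) ≤ X * ENNReal.ofReal (b₁ i) := by
    intro i hi
    obtain ⟨j, rfl⟩ : ∃ j, n = j + i + 1 := ⟨n - 1 - i, by omega⟩
    have hj : j + i + 1 - 1 - i = j := by omega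
    rw [hj]
    refine (hFj _).trans ?_
    rw [hX, ← ENNReal.ofReal_mul (by have := htail (j + i + 1); positivity)]
    refine ENNReal.ofReal_le_ofReal ?_
    have h1 : tail ω (dyad j) ≤ C ^ (i + 1) * tail ω (dyad (j + i + 1)) := hup j (i + 1)
    have h2 : dyad (j + 1) ^ k ≤ 2 * Real.exp (-2 ^ i) := by
      have e1 : dyad (j + 1) ^ (k + 1) ≤ Real.exp (-2 ^ i) := by
        refine (pow_le_pow_of_le_one (dyad_nonneg _) (dyad_lt_one _).le hk).trans ?_
        rw [add_comm j i]
        exact dyad_succ_pow_le_exp j i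
      rw [pow_succ] at e1
      have e2 := half_le_dyad_succ j
      have e3 := pow_nonneg (dyad_nonneg (j + 1)) k
      nlinarith
    have h3 : ((2 : ℝ) ^ (j + 1)) ^ η ≤ (2 ^ (j + i + 1)) ^ η := by
      refine Real.rpow_le_rpow (by positivity) ?_ h0
      exact pow_le_pow_right₀ one_le_two (by omega)
    calc ((2 : ℝ) ^ (j + 1)) ^ η * dyad (j + 1) ^ k * tail ω (dyad j)
        ≤ (2 ^ (j + i + 1)) ^ η * (2 * Real.exp (-2 ^ i)) * (C ^ (i + 1) * tail ω (dyad (j + i + 1))) := by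
          have := htail j
          have := pow_nonneg (dyad_nonneg (j + 1)) k
          gcongr
      _ = (2 ^ (j + i + 1)) ^ η * tail ω (dyad (j + i + 1)) * b₁ i := by
          rw [hb₁]; ring
  rw [lintegral_Ioo_eq_tsum_dyad]
  change ∑' j, F j ≤ _
  rw [← ENNReal.summable.sum_add_tsum_nat_add' (k := n), add_mul]
  refine add_le_add ?_ ?_
  · rw [← Finset.sum_range_reflect]
    refine (Finset.sum_le_sum fun i hi => hlow' i (Finset.mem_range.1 hi)).trans ?_
    rw [← Finset.mul_sum, mul_comm]
    gcongr
    exact ENNReal.sum_le_tsum _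
  · refine (ENNReal.tsum_le_tsum hhigh).trans ?_
    rw [ENNReal.tsum_mul_left, mul_comm]

/-- A dyadic discretization of the integral of a monotone function against a doubling weight. -/
lemma IsDoublingWeight.exists_tsum_mul_tail_le (hω : IsDoublingWeight ω) (c : ℕ) :
    ∃ D : ℝ≥0∞, D ≠ ⊤ ∧ ∀ G : ℝ → ℝ≥0∞, MonotoneOn G (Ico 0 1) →
      ∑' n, G (dyad (n + c)) * ENNReal.ofReal (tail ω (dyad n)) ≤
        D * ∫⁻ r in Ioo (0 : ℝ) 1, G r * ENNReal.ofReal (ω (r : ℂ)) := by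
  obtain ⟨C, hC, hup⟩ := hω.exists_tail_le_pow_mul
  obtain ⟨m, B, hB, hlow⟩ := hω.exists_mul_tail_le
  have hB0 : 0 < B := by linarith
  have hC0 : 0 < C := by linarith
  -- `B * t' ≤ t` is the same as `t ≤ B / (B - 1) * (t - t')`, so a tail is controlled by the mass
  -- of the next `m` annuli. Monotonicity moves `G (dyad n)` onto these, and each annulus is used at
  -- most `m` times.
  set E : ℝ := B / (B - 1) with hE
  have hE0 : 0 ≤ E := div_nonneg hB0.le (by linarith)
  refine ⟨ENNReal.ofReal (C ^ c) * (ENNReal.ofReal E * m),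
    ENNReal.mul_ne_top ENNReal.ofReal_ne_top
      (ENNReal.mul_ne_top ENNReal.ofReal_ne_top (ENNReal.natCast_ne_top m)), fun G hG => ?_⟩
  set τ : ℕ → ℝ≥0∞ := fun n => ENNReal.ofReal (tail ω (dyad n)) with hτ
  set d : ℕ → ℝ≥0∞ := fun n => ∫⁻ t in Ico (dyad n) (dyad (n + 1)), ENNReal.ofReal (ω (t : ℂ)) with hd
  have hsplit : ∀ n i, τ n = ∑ j ∈ Finset.range i, d (n + j) + τ (n + i) := by
    intro n i
    induction i with
    | zero => simp
    | succ i ih =>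
      rw [ih, Finset.sum_range_succ, add_assoc]
      congr 1
      simp only [hτ, hd, hω.weight.ofReal_tail_Ico]
      rw [← add_assoc, ← lintegral_union measurableSet_Ico, Ico_union_Ico_eq_Ico
        (dyad_mono (Nat.le_succ _)) (dyad_lt_one _).le]
      exact Set.disjoint_left.2 fun x hx hx' => not_le.2 hx.2 hx'.1
  have hτd : ∀ n, τ n ≤ ENNReal.ofReal E * ∑ j ∈ Finset.range m, d (n + j) := by
    intro n
    have h1 := hlow n
    have h2 : ENNReal.ofReal (tail ω (dyad n) - tail ω (dyad (n + m))) ≤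
        ∑ j ∈ Finset.range m, d (n + j) := by
      rw [ENNReal.ofReal_sub _ (hω.weight.tail_nonneg (dyad_nonneg _))]
      exact tsub_le_iff_right.2 (hsplit n m).le
    calc τ n ≤ ENNReal.ofReal (E * (tail ω (dyad n) - tail ω (dyad (n + m)))) := by
          refine ENNReal.ofReal_le_ofReal ?_
          rw [hE, div_mul_eq_mul_div, le_div_iff₀ (by linarith)]
          nlinarith
      _ = ENNReal.ofReal E * ENNReal.ofReal (tail ω (dyad n) - tail ω (dyad (n + m))) :=
          ENNReal.ofReal_mul hE0
      _ ≤ _ := by gcongr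
  have hmem : ∀ n, dyad n ∈ Ico (0 : ℝ) 1 := fun n => ⟨dyad_nonneg n, dyad_lt_one n⟩
  have hGd : ∀ i n, G (dyad n) * d (n + i) ≤
      ∫⁻ r in Ico (dyad (n + i)) (dyad (n + i + 1)), G r * ENNReal.ofReal (ω (r : ℂ)) := by
    intro i n
    refine (lintegral_const_mul_le _ _).trans (lintegral_mono_ae ?_)
    refine (ae_restrict_iff' measurableSet_Ico).2 (ae_of_all _ fun r hr => ?_)
    gcongr
    have h1 : dyad n ≤ r := (dyad_mono (Nat.le_add_right n i)).trans hr.1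
    exact hG (hmem n) ⟨(dyad_nonneg n).trans h1, hr.2.trans (dyad_lt_one _)⟩ h1
  have hstep : ∑' n, G (dyad n) * τ n ≤
      ENNReal.ofReal E * m * ∫⁻ r in Ioo (0 : ℝ) 1, G r * ENNReal.ofReal (ω (r : ℂ)) := by
    calc ∑' n, G (dyad n) * τ n
        ≤ ∑' n, ENNReal.ofReal E * ∑ i ∈ Finset.range m, G (dyad n) * d (n + i) := by
          refine ENNReal.tsum_le_tsum fun n => ?_
          rw [← Finset.mul_sum, mul_left_comm]
          gcongr
          exact hτd n
      _ = ENNReal.ofReal E * ∑ i ∈ Finset.range m, ∑' n, G (dyad n) * d (n + i) := by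
          rw [ENNReal.tsum_mul_left, Summable.tsum_finsetSum fun _ _ => ENNReal.summable]
      _ ≤ ENNReal.ofReal E * ∑ i ∈ Finset.range m,
            ∫⁻ r in Ioo (0 : ℝ) 1, G r * ENNReal.ofReal (ω (r : ℂ)) := by
          gcongr with i hi
          refine (ENNReal.tsum_le_tsum (hGd i)).trans ?_
          rw [lintegral_Ioo_eq_tsum_dyad]
          exact ENNReal.tsum_comp_le_tsum_of_injective (add_left_injective i)
            (fun j => ∫⁻ r in Ico (dyad j) (dyad (j + 1)), G r * ENNReal.ofReal (ω (r : ℂ)))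
      _ = _ := by
          rw [Finset.sum_const, Finset.card_range, nsmul_eq_mul, mul_assoc]
  -- Shifting the tail to the radius where `G` is evaluated costs `C ^ c` by upper doubling.
  calc ∑' n, G (dyad (n + c)) * τ n
      ≤ ∑' n, ENNReal.ofReal (C ^ c) * (G (dyad (n + c)) * τ (n + c)) := by
        refine ENNReal.tsum_le_tsum fun n => ?_
        rw [mul_left_comm]
        gcongr
        rw [hτ, ← ENNReal.ofReal_mul (by positivity)]
        exact ENNReal.ofReal_le_ofReal (hup n c)
    _ = ENNReal.ofReal (C ^ c) * ∑' n, G (dyad (n + c)) * τ (n + c) := ENNReal.tsum_mul_left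
    _ ≤ ENNReal.ofReal (C ^ c) * ∑' n, G (dyad n) * τ n := by
        refine mul_le_mul' le_rfl ?_
        exact ENNReal.tsum_comp_le_tsum_of_injective (add_left_injective c)
          (fun n => G (dyad n) * τ n)
    _ ≤ _ := by
        rw [mul_assoc]
        gcongr

end Weight

/-! ### Taylor coefficients, circle means and maximum modulus -/

lemma isOpen_disc : IsOpen disc := isOpen_ball

lemma mem_disc {z : ℂ} : z ∈ disc ↔ ‖z‖ < 1 := by simp [disc]

lemma zero_mem_disc : (0 : ℂ) ∈ disc := by simp [disc]

lemma sphere_subset_disc {r : ℝ} (hr : r < 1) : sphere (0 : ℂ) r ⊆ disc := fun z hz => by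
  rw [mem_disc, mem_sphere_zero_iff_norm.1 hz]; exact hr

lemma closedBall_subset_disc {r : ℝ} (hr : r < 1) : closedBall (0 : ℂ) r ⊆ disc :=
  closedBall_subset_ball hr

lemma circleIntegrable_of_continuousOn_disc {E : Type*} [NormedAddCommGroup E] {f : ℂ → E} {r : ℝ}
    (hf : ContinuousOn f disc) (h0 : 0 ≤ r) (hr : r < 1) : CircleIntegrable f 0 r :=
  (hf.mono (sphere_subset_disc hr)).circleIntegrable h0

lemma deriv_differentiableOn_disc {f : ℂ → ℂ} (hf : DifferentiableOn ℂ f disc) :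
    DifferentiableOn ℂ (deriv f) disc := hf.deriv isOpen_disc

lemma hasSum_coeff {f : ℂ → ℂ} (hf : DifferentiableOn ℂ f disc) {z : ℂ} (hz : z ∈ disc) :
    HasSum (fun k => coeff f k * z ^ k) (f z) := by
  have h := Complex.hasSum_taylorSeries_on_ball hf hz
  refine h.congr_fun ?_
  intro k
  simp only [coeff, sub_zero, smul_eq_mul]
  ring

lemma coeff_zero (f : ℂ → ℂ) : coeff f 0 = f 0 := by simp [coeff]

lemma coeff_deriv (f : ℂ → ℂ) (k : ℕ) : coeff (deriv f) k = (k + 1) * coeff f (k + 1) := by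
  unfold coeff
  rw [← iteratedDeriv_succ', Nat.factorial_succ]
  have h1 : (k.factorial : ℂ) ≠ 0 := by exact_mod_cast k.factorial_ne_zero
  have h2 : (k : ℂ) + 1 ≠ 0 := by exact_mod_cast k.succ_ne_zero
  push_cast
  field_simp

lemma summable_norm_coeff {f : ℂ → ℂ} (hf : DifferentiableOn ℂ f disc) {r : ℝ} (h0 : 0 ≤ r)
    (hr : r < 1) : Summable fun k => ‖coeff f k‖ * r ^ k := by
  have h : (r : ℂ) ∈ disc := by rw [mem_disc, Complex.norm_real, Real.norm_of_nonneg h0]; exact hr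
  have h1 := (hasSum_coeff hf h).summable.norm
  simpa [abs_of_nonneg h0] using h1

lemma hasSum_circleAverage {F : ℕ → ℂ → ℂ} {f : ℂ → ℂ} {b : ℕ → ℝ} {r : ℝ} (h0 : 0 ≤ r)
    (hF : ∀ k, ContinuousOn (F k) (sphere 0 r)) (hb : Summable b)
    (hFb : ∀ k, ∀ z ∈ sphere (0 : ℂ) r, ‖F k z‖ ≤ b k)
    (hsum : ∀ z ∈ sphere (0 : ℂ) r, HasSum (fun k => F k z) (f z)) :
    HasSum (fun k => Real.circleAverage (F k) 0 r) (Real.circleAverage f 0 r) := by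
  unfold Real.circleAverage
  refine HasSum.const_smul _ ?_
  refine intervalIntegral.hasSum_integral_of_dominated_convergence (fun k _ => b k) ?_ ?_ ?_ ?_ ?_
  · intro k
    have : Continuous fun θ => F k (circleMap 0 r θ) :=
      (hF k).comp_continuous (continuous_circleMap 0 r) (fun θ => circleMap_mem_sphere 0 h0 θ)
    exact this.aestronglyMeasurable
  · exact fun k => ae_of_all _ fun θ _ => hFb k _ (circleMap_mem_sphere 0 h0 θ)
  · exact ae_of_all _ fun θ _ => hb
  · simp
  · exact ae_of_all _ fun θ _ => hsum _ (circleMap_mem_sphere 0 h0 θ)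

lemma circleAverage_of_differentiableOn_disc {f : ℂ → ℂ} (hf : DifferentiableOn ℂ f disc) {r : ℝ}
    (h0 : 0 ≤ r) (hr : r < 1) : Real.circleAverage f 0 r = f 0 := by
  refine DiffContOnCl.circleAverage ?_
  rw [abs_of_nonneg h0]
  refine DifferentiableOn.diffContOnCl (hf.mono ?_)
  exact closure_ball_subset_closedBall.trans (closedBall_subset_disc hr)

lemma circleAverage_conj (f : ℂ → ℂ) (r : ℝ) :
    Real.circleAverage (fun z => conj (f z)) 0 r = conj (Real.circleAverage f 0 r) := by
  unfold Real.circleAverage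
  rw [intervalIntegral.intervalIntegral_eq_integral_uIoc,
    intervalIntegral.intervalIntegral_eq_integral_uIoc, integral_conj]
  simp only [map_mul, Complex.real_smul, Complex.conj_ofReal, uIoc_of_le Real.two_pi_pos.le,
    if_pos Real.two_pi_pos.le, one_smul]

/-- On the circle `z * conj z = r ^ 2`, which cancels the common powers and leaves a positive power
of `z` or of its conjugate, of mean zero unless `j = k`. -/
lemma circleAverage_pow_mul_conj_pow (j k : ℕ) {r : ℝ} (h0 : 0 ≤ r) :
    Real.circleAverage (fun z => z ^ j * conj z ^ k) 0 r = if j = k then (r : ℂ) ^ (2 * k) else 0 := by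
  have hz : ∀ z ∈ sphere (0 : ℂ) |r|, z * conj z = (r : ℂ) ^ 2 := by
    intro z hz
    rw [abs_of_nonneg h0] at hz
    rw [Complex.mul_conj, Complex.normSq_eq_norm_sq, mem_sphere_zero_iff_norm.1 hz]
    push_cast; rfl
  have hpow : ∀ m, m ≠ 0 → Real.circleAverage (fun z : ℂ => z ^ m) 0 r = 0 := by
    intro m hm
    rw [DiffContOnCl.circleAverage, zero_pow hm]
    exact (differentiable_pow m).diffContOnCl
  rcases lt_trichotomy j k with h | rfl | h
  · rw [if_neg h.ne]
    obtain ⟨m, rfl⟩ := Nat.exists_eq_add_of_lt h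
    have : EqOn (fun z : ℂ => z ^ j * conj z ^ (j + m + 1))
        (fun z => ((r : ℂ) ^ 2) ^ j • conj (z ^ (m + 1))) (sphere 0 |r|) := by
      intro z hz'
      simp only [smul_eq_mul, ← hz z hz', map_pow]
      ring
    rw [Real.circleAverage_congr_sphere this, Real.circleAverage_fun_smul, circleAverage_conj,
      hpow _ (Nat.succ_ne_zero m)]
    simp
  · rw [if_pos rfl]
    refine Real.circleAverage_const_on_circle fun z hz' => ?_
    rw [← mul_pow, hz z hz', pow_mul]
  · rw [if_neg h.ne']
    obtain ⟨m, rfl⟩ := Nat.exists_eq_add_of_lt h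
    have : EqOn (fun z : ℂ => z ^ (k + m + 1) * conj z ^ k)
        (fun z => ((r : ℂ) ^ 2) ^ k • z ^ (m + 1)) (sphere 0 |r|) := by
      intro z hz'
      simp only [smul_eq_mul, ← hz z hz']
      ring
    rw [Real.circleAverage_congr_sphere this, Real.circleAverage_fun_smul,
      hpow _ (Nat.succ_ne_zero m)]
    simp

/-- Termwise integration of the Taylor series against a continuous function on a circle. -/
lemma hasSum_circleAverage_mul {f w : ℂ → ℂ} (hf : DifferentiableOn ℂ f disc)
    {r : ℝ} (h0 : 0 ≤ r) (hr : r < 1) (hw : ContinuousOn w (sphere 0 r)) :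
    HasSum (fun k => coeff f k * Real.circleAverage (fun z => z ^ k * w z) 0 r)
      (Real.circleAverage (fun z => f z * w z) 0 r) := by
  obtain ⟨B, hB⟩ := (isCompact_sphere (0 : ℂ) r).exists_bound_of_continuousOn hw
  have h := hasSum_circleAverage (F := fun k z => coeff f k • (z ^ k * w z))
    (f := fun z => f z * w z) (b := fun k => ‖coeff f k‖ * r ^ k * B) h0 ?_ ?_ ?_ ?_
  · simp only [Real.circleAverage_fun_smul] at h
    exact h
  · intro k
    fun_prop
  · exact (summable_norm_coeff hf h0 hr).mul_right B
  · intro k z hz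
    rw [norm_smul, norm_mul, norm_pow, mem_sphere_zero_iff_norm.1 hz, mul_assoc]
    gcongr
    exact hB z hz
  · intro z hz
    simpa [mul_assoc] using (hasSum_coeff hf (sphere_subset_disc hr hz)).mul_right (w z)

lemma circleAverage_mul_conj_pow {f : ℂ → ℂ} (hf : DifferentiableOn ℂ f disc)
    {r : ℝ} (h0 : 0 ≤ r) (hr : r < 1) (k : ℕ) :
    Real.circleAverage (fun z => f z * conj z ^ k) 0 r = coeff f k * (r : ℂ) ^ (2 * k) := by
  have h := hasSum_circleAverage_mul hf h0 hr (w := fun z => conj z ^ k) (by fun_prop)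
  refine h.unique ?_
  convert hasSum_ite_eq k (coeff f k * (r : ℂ) ^ (2 * k)) using 2 with j
  rw [circleAverage_pow_mul_conj_pow _ _ h0]
  split_ifs with h1
  · rw [h1]
  · simp

lemma norm_circleAverage_le {f : ℂ → ℂ} {g : ℂ → ℝ} {r : ℝ} (h0 : 0 ≤ r)
    (hg : CircleIntegrable g 0 r) (h : ∀ z ∈ sphere (0 : ℂ) r, ‖f z‖ ≤ g z) :
    ‖Real.circleAverage f 0 r‖ ≤ Real.circleAverage g 0 r := by
  unfold Real.circleAverage
  rw [norm_smul, smul_eq_mul, Real.norm_of_nonneg (by positivity)]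
  gcongr
  exact intervalIntegral.norm_integral_le_of_norm_le (by positivity)
    (ae_of_all _ fun θ _ => h _ (circleMap_mem_sphere 0 h0 θ)) hg

/-- Cauchy's estimate with the integral mean. -/
lemma norm_coeff_mul_pow_le_circleAverage {f : ℂ → ℂ} (hf : DifferentiableOn ℂ f disc)
    {r : ℝ} (h0 : 0 < r) (hr : r < 1) (k : ℕ) :
    ‖coeff f k‖ * r ^ k ≤ Real.circleAverage (fun z => ‖f z‖) 0 r := by
  have h1 := norm_circleAverage_le (f := fun z => f z * conj z ^ k) (g := fun z => r ^ k • ‖f z‖)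
    h0.le ?_ ?_
  · rw [circleAverage_mul_conj_pow hf h0.le hr, Real.circleAverage_fun_smul, norm_mul, norm_pow,
      Complex.norm_real, Real.norm_of_nonneg h0.le, smul_eq_mul, two_mul, pow_add, ← mul_assoc,
      mul_comm (r ^ k)] at h1
    exact le_of_mul_le_mul_right h1 (pow_pos h0 k)
  · have := hf.continuousOn
    exact circleIntegrable_of_continuousOn_disc (by fun_prop) h0.le hr
  · intro z hz
    simp [mem_sphere_zero_iff_norm.1 hz, mul_comm]

/-- Parseval's identity on a circle. -/
lemma hasSum_norm_sq_coeff {f : ℂ → ℂ} (hf : DifferentiableOn ℂ f disc)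
    {r : ℝ} (h0 : 0 ≤ r) (hr : r < 1) :
    HasSum (fun k => ‖coeff f k‖ ^ 2 * r ^ (2 * k)) (Real.circleAverage (fun z => ‖f z‖ ^ 2) 0 r) := by
  -- Testing the series against `conj f` itself; each mean is then a conjugated coefficient.
  have h := hasSum_circleAverage_mul hf h0 hr (w := fun z => conj (f z))
    (Complex.continuous_conj.comp_continuousOn (hf.continuousOn.mono (sphere_subset_disc hr)))
  have e1 : ∀ k, Real.circleAverage (fun z => z ^ k * conj (f z)) 0 r =
      conj (coeff f k) * (r : ℂ) ^ (2 * k) := by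
    intro k
    have := circleAverage_conj (fun z => f z * conj z ^ k) r
    rw [circleAverage_mul_conj_pow hf h0 hr] at this
    simp only [map_mul, map_pow, Complex.conj_conj, Complex.conj_ofReal] at this
    rw [← this]
    congr 1; ext z; ring
  have e2 : Real.circleAverage (fun z => f z * conj (f z)) 0 r =
      ((Real.circleAverage (fun z => ‖f z‖ ^ 2) 0 r : ℝ) : ℂ) := by
    have := (Complex.ofRealCLM).circleAverage_comp_comm (f := fun z => ‖f z‖ ^ 2) (c := 0) (R := r)
      (circleIntegrable_of_continuousOn_disc (hf.continuousOn.norm.pow 2) h0 hr)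
    rw [Complex.ofRealCLM_apply] at this
    rw [← this]
    congr 1; ext z
    simp [Complex.mul_conj, Complex.normSq_eq_norm_sq]
  rw [e2] at h
  rw [← Complex.hasSum_ofReal]
  convert h using 2 with k
  rw [e1, ← mul_assoc, Complex.mul_conj, Complex.normSq_eq_norm_sq]
  push_cast; rfl

/-! ### Maximum modulus -/

lemma bddAbove_norm_image_sphere {f : ℂ → ℂ} (hf : DifferentiableOn ℂ f disc) {r : ℝ}
    (hr : r < 1) : BddAbove ((fun z => ‖f z‖) '' sphere 0 r) :=
  (isCompact_sphere 0 r).bddAbove_image (hf.continuousOn.mono (sphere_subset_disc hr)).norm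

lemma maxModulus_nonneg (r : ℝ) (f : ℂ → ℂ) : 0 ≤ maxModulus r f :=
  Real.sSup_nonneg (by rintro _ ⟨z, _, rfl⟩; exact norm_nonneg _)

lemma norm_le_maxModulus_of_mem_sphere {f : ℂ → ℂ} (hf : DifferentiableOn ℂ f disc) {r : ℝ}
    (hr : r < 1) {z : ℂ} (hz : z ∈ sphere (0 : ℂ) r) : ‖f z‖ ≤ maxModulus r f :=
  le_csSup (bddAbove_norm_image_sphere hf hr) ⟨z, hz, rfl⟩

/-- The maximum modulus principle. -/
lemma norm_le_maxModulus {f : ℂ → ℂ} (hf : DifferentiableOn ℂ f disc) {r : ℝ}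
    (hr : r < 1) {z : ℂ} (hz : ‖z‖ ≤ r) : ‖f z‖ ≤ maxModulus r f := by
  rcases hz.eq_or_lt with h | h
  · exact norm_le_maxModulus_of_mem_sphere hf hr (by simpa using h)
  · have hr0 : 0 < r := (norm_nonneg z).trans_lt h
    refine Complex.norm_le_of_forall_mem_frontier_norm_le (U := ball 0 r) isBounded_ball
      (DifferentiableOn.diffContOnCl (hf.mono ?_)) ?_ (subset_closure (by simpa using h))
    · exact closure_ball_subset_closedBall.trans (closedBall_subset_disc hr)
    · rw [frontier_ball _ hr0.ne']
      exact fun w hw => norm_le_maxModulus_of_mem_sphere hf hr hw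

lemma maxModulus_le {f : ℂ → ℂ} {r B : ℝ} (hB : 0 ≤ B)
    (h : ∀ z ∈ sphere (0 : ℂ) r, ‖f z‖ ≤ B) : maxModulus r f ≤ B :=
  Real.sSup_le (by rintro _ ⟨z, hz, rfl⟩; exact h z hz) hB

lemma maxModulus_mono {f : ℂ → ℂ} (hf : DifferentiableOn ℂ f disc) {r s : ℝ} (h : r ≤ s)
    (hs : s < 1) : maxModulus r f ≤ maxModulus s f :=
  maxModulus_le (maxModulus_nonneg _ _) fun _ hz =>
    norm_le_maxModulus hf hs ((mem_sphere_zero_iff_norm.1 hz).le.trans h)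

lemma maxModulus_le_tsum {f : ℂ → ℂ} (hf : DifferentiableOn ℂ f disc) {r : ℝ} (h0 : 0 ≤ r)
    (hr : r < 1) : maxModulus r f ≤ ∑' k, ‖coeff f k‖ * r ^ k := by
  refine maxModulus_le (tsum_nonneg fun k => by positivity) fun z hz => ?_
  rw [← (hasSum_coeff hf (sphere_subset_disc hr hz)).tsum_eq]
  have hn : ∀ k, ‖coeff f k * z ^ k‖ = ‖coeff f k‖ * r ^ k := fun k => by
    rw [norm_mul, norm_pow, mem_sphere_zero_iff_norm.1 hz]
  refine (norm_tsum_le_tsum_norm ?_).trans_eq ?_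
  · simpa only [hn] using summable_norm_coeff hf h0 hr
  · simp only [hn]

lemma norm_coeff_mul_pow_le_maxModulus {f : ℂ → ℂ} (hf : DifferentiableOn ℂ f disc)
    {r : ℝ} (h0 : 0 < r) (hr : r < 1) (k : ℕ) : ‖coeff f k‖ * r ^ k ≤ maxModulus r f := by
  refine (norm_coeff_mul_pow_le_circleAverage hf h0 hr k).trans ?_
  refine Real.circleAverage_mono_on_of_le_circle
    (circleIntegrable_of_continuousOn_disc hf.continuousOn.norm h0.le hr) fun z hz => ?_
  rw [abs_of_pos h0] at hz
  exact norm_le_maxModulus_of_mem_sphere hf hr hz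

/-! ### The area theorem for univalent functions -/

/-- The real determinant of multiplication by `w` is the algebra norm of `w` over `ℝ`; this is the
Jacobian in the area formula. -/
lemma abs_det_smul_one (w : ℂ) :
    |((w • (1 : ℂ →L[ℝ] ℂ)) : ℂ →L[ℝ] ℂ).det| = ‖w‖ ^ 2 := by
  have h : (((w • (1 : ℂ →L[ℝ] ℂ)) : ℂ →L[ℝ] ℂ) : ℂ →ₗ[ℝ] ℂ) = Algebra.lmul ℝ ℂ w := by
    ext; simp
  rw [ContinuousLinearMap.det, h, ← Algebra.norm_apply, Algebra.norm_complex_apply,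
    Complex.normSq_eq_norm_sq, abs_of_nonneg (sq_nonneg _)]

/-- By injectivity the integral is the area of the image of the ball, which lies in a closed disc of
radius `maxModulus R f`. -/
lemma lintegral_norm_deriv_sq_le {f : ℂ → ℂ} (hf : f ∈ Univalent) {R : ℝ} (hR : R < 1) :
    ∫⁻ z in ball (0 : ℂ) R, ENNReal.ofReal (‖deriv f z‖ ^ 2) ≤
      ENNReal.ofReal (Real.pi * maxModulus R f ^ 2) := by
  have hsub : ball (0 : ℂ) R ⊆ disc := ball_subset_ball hR.le
  have h := lintegral_abs_det_fderiv_eq_addHaar_image (μ := volume) (s := ball (0 : ℂ) R) (f := f)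
    (f' := fun z => deriv f z • (1 : ℂ →L[ℝ] ℂ)) measurableSet_ball
    (fun z hz => ((hf.1.differentiableAt
      (isOpen_disc.mem_nhds (hsub hz))).hasDerivAt.complexToReal_fderiv).hasFDerivWithinAt)
    (hf.2.mono hsub)
  simp only [abs_det_smul_one] at h
  rw [h]
  refine (measure_mono (t := closedBall 0 (maxModulus R f)) ?_).trans ?_
  · rintro _ ⟨z, hz, rfl⟩
    rw [mem_closedBall_zero_iff]
    exact norm_le_maxModulus hf.1 hR (mem_ball_zero_iff.1 hz).le
  · rw [Complex.volume_closedBall, mul_comm, ENNReal.ofReal_mul Real.pi_pos.le,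
      ENNReal.ofReal_pow (maxModulus_nonneg _ _), ENNReal.ofReal_eq_coe_nnreal Real.pi_pos.le]
    rfl

lemma lintegral_circle_eq {g : ℂ → ℝ} {r : ℝ} (h0 : 0 ≤ r) (hg : ContinuousOn g (sphere 0 r))
    (hg0 : ∀ z, 0 ≤ g z) :
    ∫⁻ θ in Ioo (-Real.pi) Real.pi, ENNReal.ofReal (g (Complex.polarCoord.symm (r, θ))) =
      ENNReal.ofReal (2 * Real.pi * Real.circleAverage g 0 r) := by
  have hc : Continuous fun θ => g (circleMap 0 r θ) :=
    hg.comp_continuous (continuous_circleMap 0 r) (fun θ => circleMap_mem_sphere 0 h0 θ)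
  have h1 : 2 * Real.pi * Real.circleAverage g 0 r =
      ∫ θ in Ioo (-Real.pi) Real.pi, g (circleMap 0 r θ) := by
    rw [Real.circleAverage_eq_integral_add (-Real.pi),
      intervalIntegral.integral_comp_add_right (fun θ => g (circleMap 0 r θ)), smul_eq_mul,
      mul_inv_cancel_left₀ Real.two_pi_pos.ne', zero_add,
      intervalIntegral.integral_of_le (by linarith [Real.pi_pos]), integral_Ioc_eq_integral_Ioo]
    congr 3
    ring
  rw [h1, ofReal_integral_eq_lintegral_ofReal]
  · refine lintegral_congr fun θ => ?_
    congr 2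
    rw [Complex.polarCoord_symm_apply, circleMap, zero_add, Complex.exp_mul_I]
    simp
  · exact (hc.integrableOn_Icc).mono_set Ioo_subset_Icc_self
  · exact ae_of_all _ fun θ => hg0 _

lemma lintegral_ball_ge {g : ℂ → ℝ} (hgm : Measurable g) (hg0 : ∀ z, 0 ≤ g z)
    (hgc : ContinuousOn g disc) {R : ℝ} (hR : R < 1) :
    ∫⁻ r in Ioo 0 R, ENNReal.ofReal (2 * Real.pi * (r * Real.circleAverage g 0 r)) ≤
      ∫⁻ z in ball (0 : ℂ) R, ENNReal.ofReal (g z) := by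
  have hGm : Measurable ((ball (0 : ℂ) R).indicator fun z => ENNReal.ofReal (g z)) :=
    (hgm.ennreal_ofReal).indicator measurableSet_ball
  have hsymm : Measurable Complex.polarCoord.symm := by
    have : Continuous Complex.polarCoord.symm := by
      have : (Complex.polarCoord.symm : ℝ × ℝ → ℂ) =
          fun p => (p.1 : ℂ) * (Real.cos p.2 + Real.sin p.2 * Complex.I) := by
        ext p; exact Complex.polarCoord_symm_apply p
      rw [this]; fun_prop
    exact this.measurable
  rw [← lintegral_indicator measurableSet_ball, ← Complex.lintegral_comp_polarCoord_symm,
    polarCoord_target, Measure.volume_eq_prod, ← Measure.prod_restrict, lintegral_prod]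
  · refine le_trans ?_ (lintegral_mono_set (Ioo_subset_Ioi_self : Ioo 0 R ⊆ Ioi 0))
    refine lintegral_mono_ae ((ae_restrict_iff' measurableSet_Ioo).2 (ae_of_all _ fun r hr => ?_))
    have hball : ∀ θ : ℝ, Complex.polarCoord.symm (r, θ) ∈ ball (0 : ℂ) R := fun θ => by
      rw [mem_ball_zero_iff, Complex.norm_polarCoord_symm, abs_of_pos hr.1]; exact hr.2
    simp only [indicator_of_mem (hball _), smul_eq_mul]
    rw [lintegral_const_mul' _ _ ENNReal.ofReal_ne_top, lintegral_circle_eq hr.1.le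
      (hgc.mono (sphere_subset_disc (hr.2.trans hR))) hg0, ← ENNReal.ofReal_mul hr.1.le]
    exact le_of_eq (by ring_nf)
  · refine Measurable.aemeasurable ?_
    simp only [smul_eq_mul]
    exact (measurable_fst.ennreal_ofReal).mul (hGm.comp hsymm)

lemma norm_natCast_add_one (k : ℕ) : ‖(k : ℂ) + 1‖ = (k : ℝ) + 1 := by
  exact_mod_cast Complex.norm_natCast (k + 1)

/-- The area theorem: the area of the image of a disc under a univalent function is at most the area
of the disc of radius the maximum modulus. -/
lemma Univalent.sum_mul_norm_coeff_sq_le {f : ℂ → ℂ} (hf : f ∈ Univalent) {R : ℝ} (h0 : 0 ≤ R)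
    (hR : R < 1) (N : ℕ) :
    ∑ k ∈ Finset.range N, ((k : ℝ) + 1) * ‖coeff f (k + 1)‖ ^ 2 * R ^ (2 * (k + 1)) ≤
      maxModulus R f ^ 2 := by
  have hd := deriv_differentiableOn_disc hf.1
  have h1 := (lintegral_ball_ge (g := fun z => ‖deriv f z‖ ^ 2)
    ((measurable_deriv f).norm.pow_const 2) (fun z => sq_nonneg _) (hd.continuousOn.norm.pow 2)
    hR).trans (lintegral_norm_deriv_sq_le hf hR)
  -- A partial sum of Parseval's series for `f'`, times `2 π r`; being finite, it integrates term by
  -- term to `π` times the sum sought.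
  set P : ℝ → ℝ := fun r => ∑ k ∈ Finset.range N,
    2 * Real.pi * (((k : ℝ) + 1) ^ 2 * ‖coeff f (k + 1)‖ ^ 2) * r ^ (2 * k + 1) with hP
  have hPc : Continuous P := by fun_prop
  have hP0 : ∀ r ∈ Ioo 0 R, 0 ≤ P r := fun r hr => by
    have := hr.1.le
    rw [hP]; positivity
  have h2 : ENNReal.ofReal (∫ r in Ioo 0 R, P r) ≤ ENNReal.ofReal (Real.pi * maxModulus R f ^ 2) := by
    rw [ofReal_integral_eq_lintegral_ofReal ((hPc.integrableOn_Icc).mono_set Ioo_subset_Icc_self)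
      ((ae_restrict_iff' measurableSet_Ioo).2 (ae_of_all _ hP0))]
    refine le_trans (lintegral_mono_ae ?_) h1
    refine (ae_restrict_iff' measurableSet_Ioo).2 (ae_of_all _ fun r hr => ?_)
    refine ENNReal.ofReal_le_ofReal ?_
    have h3 := sum_le_hasSum (Finset.range N) (fun k _ => by have := hr.1.le; positivity)
      (hasSum_norm_sq_coeff hd hr.1.le (hr.2.trans hR))
    have h4 : P r = 2 * Real.pi * (r * ∑ k ∈ Finset.range N, ‖coeff (deriv f) k‖ ^ 2 * r ^ (2 * k)) := by
      rw [hP]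
      simp only [Finset.mul_sum]
      refine Finset.sum_congr rfl fun k _ => ?_
      rw [coeff_deriv, norm_mul, mul_pow, norm_natCast_add_one]
      ring
    rw [h4]
    have := hr.1
    gcongr
  have h5 : ∫ r in Ioo 0 R, P r = Real.pi *
      ∑ k ∈ Finset.range N, ((k : ℝ) + 1) * ‖coeff f (k + 1)‖ ^ 2 * R ^ (2 * (k + 1)) := by
    rw [← integral_Ioc_eq_integral_Ioo, ← intervalIntegral.integral_of_le h0, hP,
      intervalIntegral.integral_finsetSum (fun k _ => by
        apply Continuous.intervalIntegrable; fun_prop), Finset.mul_sum]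
    refine Finset.sum_congr rfl fun k _ => ?_
    rw [intervalIntegral.integral_const_mul, integral_pow]
    have : (k : ℝ) + 1 ≠ 0 := by positivity
    push_cast
    field_simp
    ring
  rw [h5, ENNReal.ofReal_le_ofReal_iff (by positivity)] at h2
  exact le_of_mul_le_mul_left h2 Real.pi_pos

/-- `n * x ^ n` is at most the geometric sum of `n` terms, and `1 - x` telescopes that sum. -/
lemma natCast_mul_pow_mul_le_one {x : ℝ} (h0 : 0 ≤ x) (h1 : x ≤ 1) (n : ℕ) :
    n * x ^ n * (1 - x) ≤ 1 := by
  have h : (n : ℝ) * x ^ n ≤ ∑ i ∈ Finset.range n, x ^ i := by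
    have := Finset.card_nsmul_le_sum (Finset.range n) (fun i => x ^ i) (x ^ n)
      (fun i hi => pow_le_pow_of_le_one h0 h1 (Finset.mem_range.1 hi).le)
    simpa using this
  have h2 := geom_sum_mul_neg x n
  have h3 := pow_nonneg h0 n
  nlinarith [mul_le_mul_of_nonneg_right h (sub_nonneg.2 h1)]

/-- Parseval for `f'` carries one more factor `k` than the area theorem. Passing from `r` to `ρ = (1
+ r) / 2` pays for it, since `k (r / ρ) ^ (2 k)` is `O(1 / (1 - r))`. The `8` is `2` from `1 - r / ρ
≥ (1 - r) / 2` times `4` from `r ^ 2 ≥ 1 / 4`. -/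
lemma Univalent.circleAverage_norm_deriv_sq_le {f : ℂ → ℂ} (hf : f ∈ Univalent) {r : ℝ}
    (h0 : 1 / 2 ≤ r) (hr : r < 1) :
    Real.circleAverage (fun z => ‖deriv f z‖ ^ 2) 0 r ≤
      8 / (1 - r) * maxModulus ((1 + r) / 2) f ^ 2 := by
  have hd := deriv_differentiableOn_disc hf.1
  set ρ : ℝ := (1 + r) / 2 with hρ
  have hr0 : 0 < r := by linarith
  have hρ0 : 0 < ρ := by linarith
  have hρ1 : ρ < 1 := by linarith
  have hd0 : 0 < 1 - r := by linarith
  refine le_of_tendsto' (hasSum_norm_sq_coeff hd hr0.le hr).tendsto_sum_nat fun N => ?_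
  refine le_trans ?_ (mul_le_mul_of_nonneg_left
    (Univalent.sum_mul_norm_coeff_sq_le hf hρ0.le hρ1 N) (by positivity))
  rw [Finset.mul_sum]
  refine Finset.sum_le_sum fun k _ => ?_
  rw [coeff_deriv, norm_mul, mul_pow, norm_natCast_add_one]
  have key : ((k : ℝ) + 1) * r ^ (2 * k) ≤ 8 / (1 - r) * ρ ^ (2 * (k + 1)) := by
    set x : ℝ := r / ρ with hx
    have hx0 : 0 ≤ x := by positivity
    have hx1 : x ≤ 1 - (1 - r) / 2 := by
      rw [hx, div_le_iff₀ hρ0]; nlinarith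
    have hrx : r = x * ρ := by rw [hx]; field_simp
    have h1 := natCast_mul_pow_mul_le_one hx0 (by linarith) (k + 1)
    have h2 : x ^ (2 * (k + 1)) ≤ x ^ (k + 1) := pow_le_pow_of_le_one hx0 (by linarith) (by omega)
    have h3 : ((k : ℝ) + 1) * x ^ (2 * (k + 1)) ≤ 2 / (1 - r) := by
      rw [le_div_iff₀ hd0]
      push_cast at h1
      calc ((k : ℝ) + 1) * x ^ (2 * (k + 1)) * (1 - r)
          ≤ ((k : ℝ) + 1) * x ^ (k + 1) * (2 * (1 - x)) := by gcongr; linarith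
        _ ≤ 2 := by linarith
    have h4 : r ^ (2 * k) ≤ 4 * r ^ (2 * (k + 1)) := by
      have : r ^ (2 * (k + 1)) = r ^ (2 * k) * r ^ 2 := by ring
      rw [this]
      have := pow_pos hr0 (2 * k)
      nlinarith [mul_le_mul_of_nonneg_left (show (1 : ℝ) / 4 ≤ r ^ 2 by nlinarith) this.le]
    have h5 : r ^ (2 * (k + 1)) = x ^ (2 * (k + 1)) * ρ ^ (2 * (k + 1)) := by
      rw [← mul_pow, ← hrx]
    calc ((k : ℝ) + 1) * r ^ (2 * k) ≤ ((k : ℝ) + 1) * (4 * r ^ (2 * (k + 1))) := by gcongr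
      _ = 4 * (((k : ℝ) + 1) * x ^ (2 * (k + 1))) * ρ ^ (2 * (k + 1)) := by rw [h5]; ring
      _ ≤ 4 * (2 / (1 - r)) * ρ ^ (2 * (k + 1)) := by gcongr
      _ = 8 / (1 - r) * ρ ^ (2 * (k + 1)) := by ring
  calc ((k : ℝ) + 1) ^ 2 * ‖coeff f (k + 1)‖ ^ 2 * r ^ (2 * k)
      = ((k : ℝ) + 1) * ‖coeff f (k + 1)‖ ^ 2 * (((k : ℝ) + 1) * r ^ (2 * k)) := by ring
    _ ≤ ((k : ℝ) + 1) * ‖coeff f (k + 1)‖ ^ 2 * (8 / (1 - r) * ρ ^ (2 * (k + 1))) := by gcongr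
    _ = _ := by ring

/-! ### Convex and close-to-convex functions -/

section Inverse

variable {g : ℂ → ℂ}

lemma hasDerivAt_of_mem_disc {f : ℂ → ℂ} (hf : DifferentiableOn ℂ f disc) {z : ℂ} (hz : z ∈ disc) :
    HasDerivAt f (deriv f z) z :=
  (hf.differentiableAt (isOpen_disc.mem_nhds hz)).hasDerivAt

lemma map_nhds_of_deriv_ne_zero (hg : DifferentiableOn ℂ g disc) {z : ℂ} (hz : z ∈ disc)
    (h : deriv g z ≠ 0) : Filter.map g (nhds z) = nhds (g z) := by
  have ha : AnalyticAt ℂ g z := hg.analyticAt (isOpen_disc.mem_nhds hz)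
  exact ha.hasStrictDerivAt.map_nhds_eq h

lemma invFunOn_mem (w : ℂ) (hw : w ∈ g '' disc) : Function.invFunOn g disc w ∈ disc :=
  Function.invFunOn_mem hw

lemma invFunOn_apply (hg : g ∈ Univalent) {z : ℂ} (hz : z ∈ disc) :
    Function.invFunOn g disc (g z) = z := hg.2.leftInvOn_invFunOn hz

/-- The inverse of a univalent function is holomorphic. -/
lemma hasDerivAt_invFunOn (hg : g ∈ Univalent) {z : ℂ} (hz : z ∈ disc) (h : deriv g z ≠ 0) :
    HasDerivAt (Function.invFunOn g disc) (deriv g z)⁻¹ (g z) := by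
  have hmap := map_nhds_of_deriv_ne_zero hg.1 hz h
  have hz' : HasDerivAt g (deriv g z) (Function.invFunOn g disc (g z)) := by
    rw [invFunOn_apply hg hz]; exact hasDerivAt_of_mem_disc hg.1 hz
  refine HasDerivAt.of_local_left_inverse ?_ hz' h ?_
  · rw [ContinuousAt, invFunOn_apply hg hz, ← hmap, Filter.tendsto_map'_iff]
    refine (Filter.tendsto_id).congr' ?_
    filter_upwards [isOpen_disc.mem_nhds hz] with x hx
    exact (invFunOn_apply hg hx).symm
  · rw [← hmap, Filter.eventually_map]
    filter_upwards [isOpen_disc.mem_nhds hz] with x hx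
    rw [invFunOn_apply hg hx]

end Inverse

/-- With the convention `x / 0 = 0`, a zero of `g'` would make the real part vanish. -/
lemma deriv_ne_zero_of_re_div_pos {f g : ℂ → ℂ} {z : ℂ} (h : 0 < (deriv f z / deriv g z).re) :
    deriv g z ≠ 0 := by
  intro h0
  simp [h0] at h

/-- The Noshiro–Warschawski theorem: close-to-convex functions are univalent. -/
lemma mem_univalent_of_closeToConvex {f g : ℂ → ℂ} (hf : DifferentiableOn ℂ f disc)
    (hg : IsConvexFunction g) (h : ∀ z ∈ disc, 0 < (deriv f z / deriv g z).re) :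
    f ∈ Univalent := by
  refine ⟨hf, fun z₁ h₁ z₂ h₂ heq => ?_⟩
  by_contra hne
  set ψ := Function.invFunOn g disc with hψ
  have hw : g z₂ - g z₁ ≠ 0 := sub_ne_zero.2 fun h' => hne (hg.1.2 h₂ h₁ h').symm
  set v := g z₂ - g z₁ with hv
  -- `f ∘ g⁻¹` along the segment from `g z₁` to `g z₂`, which stays in the convex image. The
  -- derivative of `Φ` is `Re (f' / g')`, so `Φ` cannot agree at both ends.
  set Φ : ℝ → ℝ := fun t => (f (ψ (g z₁ + t * v)) / v).re with hΦ
  have hmem : ∀ t ∈ Icc (0 : ℝ) 1, g z₁ + t * v ∈ g '' disc := by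
    intro t ht
    have := hg.2 (mem_image_of_mem g h₁) (mem_image_of_mem g h₂) (sub_nonneg.2 ht.2) ht.1
      (by ring)
    convert this using 1
    simp only [Complex.real_smul, hv]
    push_cast
    ring
  have hder : ∀ t ∈ Icc (0 : ℝ) 1, ∃ z ∈ disc,
      HasDerivAt Φ (deriv f z / deriv g z).re t := by
    intro t ht
    obtain ⟨z, hz, hzt⟩ := hmem t ht
    have hgz := deriv_ne_zero_of_re_div_pos (h z hz)
    refine ⟨z, hz, ?_⟩
    have hψz : ψ (g z₁ + t * v) = z := by rw [← hzt]; exact invFunOn_apply hg.1 hz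
    have d1 : HasDerivAt (fun s : ℂ => g z₁ + s * v) v (t : ℂ) := by
      simpa using ((hasDerivAt_id (t : ℂ)).mul_const v).const_add (g z₁)
    have d2 : HasDerivAt ψ (deriv g z)⁻¹ (g z₁ + t * v) := by
      rw [← hzt]; exact hasDerivAt_invFunOn hg.1 hz hgz
    have d3 : HasDerivAt f (deriv f z) (ψ (g z₁ + t * v)) := by
      rw [hψz]; exact hasDerivAt_of_mem_disc hf hz
    have d4 := ((d3.comp (t : ℂ) (d2.comp (t : ℂ) d1)).div_const v).real_of_complex
    rw [← mul_assoc, mul_div_cancel_right₀ _ hw, ← div_eq_mul_inv] at d4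
    exact d4
  have hmono : StrictMonoOn Φ (Icc 0 1) := by
    refine strictMonoOn_of_deriv_pos (convex_Icc 0 1) ?_ ?_
    · intro t ht
      obtain ⟨z, hz, hd⟩ := hder t ht
      exact hd.continuousAt.continuousWithinAt
    · intro t ht
      obtain ⟨z, hz, hd⟩ := hder t (interior_subset ht)
      rw [hd.deriv]
      exact h z hz
  have h01 := hmono (left_mem_Icc.2 zero_le_one) (right_mem_Icc.2 zero_le_one) one_pos
  simp only [hΦ, hv, hψ] at h01
  norm_num [invFunOn_apply hg.1 h₁, invFunOn_apply hg.1 h₂, heq] at h01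

/-! ### Differential characterization of convexity -/

/-- Consequence of the Schwarz lemma for a convex function: averages of two values at points of
modulus `‖z‖` are values at points of modulus at most `‖z‖`. -/
lemma IsConvexFunction.norm_invFunOn_le {g : ℂ → ℂ} (hg : IsConvexFunction g)
    (hg' : ∀ z ∈ disc, deriv g z ≠ 0) {z u : ℂ} (hz : z ∈ disc) (hu : ‖u‖ = 1) {s : ℝ}
    (hs : s ∈ Icc (0 : ℝ) 1) :
    ‖Function.invFunOn g disc (g z + s * (g (u * z) - g z))‖ ≤ ‖z‖ := by
  have hud : ∀ w ∈ disc, u * w ∈ disc := fun w hw => by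
    rw [mem_disc] at hw ⊢; rwa [norm_mul, hu, one_mul]
  have hmem : ∀ w ∈ disc, g w + s * (g (u * w) - g w) ∈ g '' disc := by
    intro w hw
    have := hg.2 (mem_image_of_mem g hw) (mem_image_of_mem g (hud w hw)) (sub_nonneg.2 hs.2) hs.1
      (by ring)
    convert this using 1
    simp only [Complex.real_smul]
    push_cast
    ring
  -- The map `w ↦ g⁻¹((1 - s) g(w) + s g(u w))` sends the disc into itself and fixes `0`.
  have key := Complex.norm_le_norm_of_mapsTo_ball (R := 1) (z := z)
    (f := fun w => Function.invFunOn g disc (g w + s * (g (u * w) - g w))) ?_ ?_ ?_ (mem_disc.1 hz)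
  · exact key
  · intro w hw
    obtain ⟨x, hx, hxe⟩ := hmem w hw
    have d1 : DifferentiableAt ℂ g w := (hasDerivAt_of_mem_disc hg.1.1 hw).differentiableAt
    have d2 : DifferentiableAt ℂ (fun w => g (u * w)) w :=
      (hasDerivAt_of_mem_disc hg.1.1 (hud w hw)).differentiableAt.comp w (by fun_prop)
    have d3 : DifferentiableAt ℂ (Function.invFunOn g disc) (g w + s * (g (u * w) - g w)) := by
      rw [← hxe]; exact (hasDerivAt_invFunOn hg.1 hx (hg' x hx)).differentiableAt
    exact (d3.comp w (d1.add ((d2.sub d1).const_mul _))).differentiableWithinAt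
  · intro w hw
    have := invFunOn_mem _ (hmem w hw)
    rw [mem_closedBall_zero_iff]
    exact (mem_disc.1 this).le
  · simp [invFunOn_apply hg.1 zero_mem_disc]

/-- The curve `Γ` starts at `z` and never leaves the disc of radius `‖z‖`, so the one-sided
derivative of `‖Γ‖ ^ 2` at `0` is nonpositive; division by `-‖z‖ ^ 2` gives the claim. -/
lemma IsConvexFunction.re_sub_div_nonneg {g : ℂ → ℂ} (hg : IsConvexFunction g)
    (hg' : ∀ z ∈ disc, deriv g z ≠ 0) {z u : ℂ} (hz : z ∈ disc) (hz0 : z ≠ 0) (hu : ‖u‖ = 1) :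
    0 ≤ ((g z - g (u * z)) / (z * deriv g z)).re := by
  set v := g (u * z) - g z with hv
  set Γ : ℝ → ℂ := fun s => Function.invFunOn g disc (g z + s * v) with hΓ
  have hΓ0 : Γ 0 = z := by simp [hΓ, invFunOn_apply hg.1 hz]
  have hd : HasDerivAt Γ ((deriv g z)⁻¹ * v) 0 := by
    have d1 : HasDerivAt (fun s : ℂ => g z + s * v) v ((0 : ℝ) : ℂ) := by
      simpa using ((hasDerivAt_id ((0 : ℝ) : ℂ)).mul_const v).const_add (g z)
    have d2 : HasDerivAt (Function.invFunOn g disc) (deriv g z)⁻¹ (g z + ((0 : ℝ) : ℂ) * v) := by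
      simpa using hasDerivAt_invFunOn hg.1 hz (hg' z hz)
    exact (HasDerivAt.comp (h := fun s : ℂ => g z + s * v) ((0 : ℝ) : ℂ) d2 d1).comp_ofReal
  have hN := hd.norm_sq
  rw [hΓ0] at hN
  have hmax : IsLocalMaxOn (fun s => ‖Γ s‖ ^ 2) (Icc 0 1) 0 := by
    refine Filter.eventually_of_mem self_mem_nhdsWithin fun s hs => ?_
    change ‖Γ s‖ ^ 2 ≤ ‖Γ 0‖ ^ 2
    rw [hΓ0]
    exact pow_le_pow_left₀ (norm_nonneg _) (hg.norm_invFunOn_le hg' hz hu hs) 2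
  have h1 := hmax.hasFDerivWithinAt_nonpos hN.hasFDerivAt.hasFDerivWithinAt (y := 1)
    (mem_posTangentConeAt_of_segment_subset (by rw [zero_add, segment_eq_Icc zero_le_one]))
  have h2 : (inner ℝ z ((deriv g z)⁻¹ * v) : ℝ) ≤ 0 := by
    simp at h1 ⊢
    linarith
  rw [Complex.inner] at h2
  have hg0 := hg' z hz
  have hns : 0 < Complex.normSq z := Complex.normSq_pos.2 hz0
  have h3 : (deriv g z)⁻¹ * v * (starRingEnd ℂ) z =
      ((-Complex.normSq z : ℝ) : ℂ) * ((g z - g (u * z)) / (z * deriv g z)) := by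
    have : (starRingEnd ℂ) z = (Complex.normSq z : ℂ) / z := by
      rw [← Complex.mul_conj]; field_simp
    rw [this, hv]
    push_cast
    field_simp
    ring
  rw [h3, Complex.re_ofReal_mul] at h2
  nlinarith

/-- The classical differential characterization of convexity, necessity part. -/
lemma IsConvexFunction.re_nonneg {g : ℂ → ℂ} (hg : IsConvexFunction g)
    (hg' : ∀ z ∈ disc, deriv g z ≠ 0) {z : ℂ} (hz : z ∈ disc) :
    0 ≤ (1 + z * (deriv (deriv g) z / deriv g z)).re := by
  rcases eq_or_ne z 0 with rfl | hz0
  · simp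
  by_contra! hneg
  have hgz := hg' z hz
  set κ : ℂ := (z * deriv g z)⁻¹ with hκ
  set e : ℝ → ℂ := fun t => Complex.exp (t * Complex.I) * z with he
  have hed : ∀ t, HasDerivAt e (e t * Complex.I) t := by
    intro t
    have d : HasDerivAt (fun s : ℂ => Complex.exp (s * Complex.I) * z)
        (Complex.exp (t * Complex.I) * (1 * Complex.I) * z) (t : ℂ) :=
      (((hasDerivAt_id (t : ℂ)).mul_const Complex.I).cexp).mul_const z
    convert d.comp_ofReal using 1
    rw [he]; ring
  have hmem : ∀ t, e t ∈ disc := fun t => by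
    rw [mem_disc] at hz ⊢
    simpa [he, Complex.norm_exp_ofReal_mul_I] using hz
  have he0 : e 0 = z := by simp [he]
  -- By the previous inequality with `u = exp (i t)`, `c` is nonnegative and vanishes at `0`; its
  -- second derivative there is the quantity in question.
  set c : ℝ → ℝ := fun t => ((g z - g (e t)) * κ).re with hc
  have hcd : ∀ t, HasDerivAt c ((-(deriv g (e t) * (e t * Complex.I)) * κ).re) t := by
    intro t
    have d1 : HasDerivAt (fun s => g (e s)) (deriv g (e t) * (e t * Complex.I)) t :=
      (hasDerivAt_of_mem_disc hg.1.1 (hmem t)).comp t (hed t)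
    exact (Complex.reCLM.hasFDerivAt.comp_hasDerivAt t ((d1.const_sub (g z)).mul_const κ))
  have hderiv : deriv c = fun t => (-(deriv g (e t) * (e t * Complex.I)) * κ).re :=
    funext fun t => (hcd t).deriv
  have hdd : deriv (deriv c) 0 = (1 + z * (deriv (deriv g) z / deriv g z)).re := by
    rw [hderiv]
    have d1 : HasDerivAt (fun s => deriv g (e s)) (deriv (deriv g) (e 0) * (e 0 * Complex.I)) 0 :=
      (hasDerivAt_of_mem_disc (deriv_differentiableOn_disc hg.1.1) (hmem 0)).comp 0 (hed 0)
    have d2 := (d1.mul ((hed 0).mul_const Complex.I)).neg.mul_const κ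
    have d3 := Complex.reCLM.hasFDerivAt.comp_hasDerivAt 0 d2
    refine d3.deriv.trans ?_
    rw [he0, Complex.reCLM_apply, hκ]
    congr 1
    have hI := Complex.I_mul_I
    field_simp
    ring_nf
    simp only [Complex.I_sq]
    ring
  have hc0 : c 0 = 0 := by simp [hc, he0]
  have hcn : ∀ t, 0 ≤ c t := by
    intro t
    have := hg.re_sub_div_nonneg hg' hz hz0 (Complex.norm_exp_ofReal_mul_I t)
    rwa [div_eq_mul_inv] at this
  have hmin : IsLocalMin c 0 := Filter.Eventually.of_forall fun t => by rw [hc0]; exact hcn t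
  -- A negative second derivative would make the minimum at `0` a local maximum too, so `c` would
  -- vanish near `0`, forcing that derivative to be zero.
  have hmax : IsLocalMax c 0 :=
    isLocalMax_of_deriv_deriv_neg (by rw [hdd]; exact hneg) hmin.deriv_eq_zero
      (hcd 0).continuousAt
  have hev : c =ᶠ[nhds 0] fun _ => 0 := by
    filter_upwards [hmax] with t ht
    exact le_antisymm (hc0 ▸ ht) (hcn t)
  have := hev.deriv.deriv_eq
  simp only [deriv_const'] at this
  rw [hdd] at this
  exact hneg.ne this

/-! ### Integral means attached to convex and close-to-convex functions -/

lemma circleAverage_re_of_differentiableOn_disc {H : ℂ → ℂ} (hH : DifferentiableOn ℂ H disc) {r : ℝ}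
    (h0 : 0 ≤ r) (hr : r < 1) : Real.circleAverage (fun z => (H z).re) 0 r = (H 0).re := by
  have := Complex.reCLM.circleAverage_comp_comm
    (circleIntegrable_of_continuousOn_disc hH.continuousOn h0 hr)
  rw [circleAverage_of_differentiableOn_disc hH h0 hr] at this
  exact this

/-- A mean-square estimate for holomorphic functions vanishing at the origin with real part at
least `-1`. -/
lemma circleAverage_norm_sq_le_of_re_ge {Q : ℂ → ℂ} (hQ : DifferentiableOn ℂ Q disc) (hQ0 : Q 0 = 0)
    (hre : ∀ z ∈ disc, -1 ≤ (Q z).re) {r : ℝ} (h0 : 0 ≤ r) (hr : r < 1) :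
    Real.circleAverage (fun z => ‖Q z‖ ^ 2) 0 r ≤ 4 / (1 - r) := by
  have hd0 : 0 < 1 - r := by linarith
  set B : ℝ := 2 / (1 - r) with hB
  have hB0 : 0 < B := by positivity
  have hB2 : 2 ≤ B := by rw [hB, le_div_iff₀ hd0]; linarith
  have hbound : ∀ z ∈ sphere (0 : ℂ) r, (Q z).re ≤ B := by
    intro z hz
    have hz' : ‖z‖ = r := mem_sphere_zero_iff_norm.1 hz
    have h1 := Complex.borelCaratheodory_zero (M := 1) (R := 1) (f := fun z => -Q z) (z := z) one_pos
      hQ.neg (fun w hw => by simpa using neg_le.1 (hre w hw)) one_pos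
      (sphere_subset_disc hr hz) (by simp [hQ0])
    rw [norm_neg, hz'] at h1
    refine (Complex.re_le_norm _).trans (h1.trans ?_)
    rw [hB]
    gcongr
    linarith
  -- From `(1 + Re Q)(B - Re Q) ≥ 0` and `|Q|² = 2 (Re Q)² - Re Q²` follows `|Q|² ≤ Re H`, and the
  -- mean of `Re H` is its value `2 B` at the origin.
  set H : ℂ → ℂ := fun z => ((2 * B : ℝ) : ℂ) + ((2 * (B - 1) : ℝ) : ℂ) * Q z - Q z ^ 2 with hH
  have hHd : DifferentiableOn ℂ H disc := ((hQ.const_mul _).const_add _).sub (hQ.pow 2)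
  have havg := circleAverage_re_of_differentiableOn_disc hHd h0 hr
  have hH0 : (H 0).re = 4 / (1 - r) := by
    simp only [hH, hQ0, mul_zero, add_zero, ne_eq, OfNat.ofNat_ne_zero, not_false_eq_true, zero_pow,
      sub_zero, Complex.ofReal_re, hB]
    ring
  rw [← hH0, ← havg]
  refine Real.circleAverage_mono
    (circleIntegrable_of_continuousOn_disc (hQ.continuousOn.norm.pow 2) h0 hr)
    (circleIntegrable_of_continuousOn_disc
      (Complex.continuous_re.comp_continuousOn hHd.continuousOn) h0 hr) fun z hz => ?_
  rw [abs_of_nonneg h0] at hz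
  have h1 := hbound z hz
  have h2 := hre z (sphere_subset_disc hr hz)
  simp only [hH, Complex.sub_re, Complex.add_re, Complex.ofReal_re, Complex.re_ofReal_mul]
  rw [← Complex.normSq_eq_norm_sq, Complex.normSq_apply, sq, Complex.mul_re]
  nlinarith [mul_nonneg (sub_nonneg.2 h1) (by linarith : 0 ≤ 1 + (Q z).re)]

/-- The Schwarz–Pick estimate for functions with positive real part. -/
lemma norm_deriv_le_of_re_pos {h : ℂ → ℂ} (hh : DifferentiableOn ℂ h disc)
    (hpos : ∀ z ∈ disc, 0 < (h z).re) {z : ℂ} (hz : z ∈ disc) :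
    ‖deriv h z‖ ≤ 2 * (h z).re / (1 - ‖z‖) := by
  have hz1 : ‖z‖ < 1 := mem_disc.1 hz
  have hsub : ball z (1 - ‖z‖) ⊆ disc := ball_subset_ball' (by simp)
  have hne : ∀ w ∈ disc, h w + conj (h z) ≠ 0 := fun w hw h0 => by
    have := congrArg Complex.re h0
    simp at this
    linarith [hpos w hw, hpos z hz]
  -- The Cayley map taking the right half-plane to the unit disc and `h z` to `0`; the Schwarz lemma
  -- is applied on the ball of radius `1 - ‖z‖` about `z`.
  set φ : ℂ → ℂ := fun w => (h w - h z) / (h w + conj (h z)) with hφ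
  have hφd : DifferentiableOn ℂ φ disc := (hh.sub_const _).div (hh.add_const _) hne
  have hφz : φ z = 0 := by simp [hφ]
  have h1 := Complex.norm_deriv_le_div_of_mapsTo_ball (R₂ := 1) (hφd.mono hsub) (fun w hw => by
    rw [hφz, mem_closedBall_zero_iff, hφ]
    simp only [norm_div]
    refine div_le_one_of_le₀ ?_ (norm_nonneg _)
    rw [← sq_le_sq₀ (norm_nonneg _) (norm_nonneg _), ← Complex.normSq_eq_norm_sq,
      ← Complex.normSq_eq_norm_sq, Complex.normSq_apply, Complex.normSq_apply]
    simp only [Complex.sub_re, Complex.sub_im, Complex.add_re, Complex.add_im, Complex.conj_re,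
      Complex.conj_im]
    nlinarith [mul_pos (hpos w (hsub hw)) (hpos z hz)]) (sub_pos.2 hz1)
  have hsum : h z + conj (h z) = ((2 * (h z).re : ℝ) : ℂ) := by
    rw [Complex.add_conj]
  have hder : deriv φ z = deriv h z / ((2 * (h z).re : ℝ) : ℂ) := by
    have d := hasDerivAt_of_mem_disc hh hz
    have d2 := (d.sub_const (h z)).div (d.add_const (conj (h z))) (hne z hz)
    refine d2.deriv.trans ?_
    rw [sub_self, zero_mul, sub_zero, sq, mul_div_mul_right _ _ (hne z hz), hsum]
  have h2 : 0 < 2 * (h z).re := by linarith [hpos z hz]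
  rw [hder, norm_div, Complex.norm_real, Real.norm_of_nonneg h2.le, div_le_iff₀ h2] at h1
  calc ‖deriv h z‖ ≤ _ := h1
    _ = _ := by ring

/-- If `S' = i q S`, the argument of `S` turns at speed `Re q` and `log |S|` changes at rate `-Im
q`; normalizing leaves only the rotation. -/
lemma hasDerivAt_conj_div_norm {S : ℝ → ℂ} {q : ℂ} {θ : ℝ} (h : HasDerivAt S (Complex.I * q * S θ) θ)
    (h0 : S θ ≠ 0) :
    HasDerivAt (fun t => conj (S t) / (‖S t‖ : ℂ))
      (-(Complex.I * (q.re : ℂ) * (conj (S θ) / (‖S θ‖ : ℂ)))) θ := by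
  have hn : ‖S θ‖ ≠ 0 := norm_ne_zero_iff.2 h0
  have d1 : HasDerivAt (fun t => conj (S t)) (conj (Complex.I * q * S θ)) θ :=
    Complex.conjCLE.toContinuousLinearMap.hasFDerivAt.comp_hasDerivAt θ h
  have d2 : HasDerivAt (fun t => ‖S t‖) (-(q.im) * ‖S θ‖) θ := by
    have e := (h.norm_sq).sqrt (by positivity)
    simp only [Real.sqrt_sq (norm_nonneg _)] at e
    convert e using 1
    rw [Complex.inner, mul_assoc, mul_assoc, Complex.mul_conj, Complex.normSq_eq_norm_sq, ← mul_assoc]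
    simp only [Complex.re_mul_ofReal, Complex.I_mul_re]
    field_simp
  have d3 := d1.div d2.ofReal_comp (by exact_mod_cast hn)
  refine HasDerivAt.congr_deriv d3 (Eq.symm ?_)
  have hn' : (‖S θ‖ : ℂ) ≠ 0 := by exact_mod_cast hn
  simp only [map_mul, Complex.conj_I]
  have hq : conj q = q.re - Complex.I * q.im := by
    apply Complex.ext <;> simp
  rw [hq]
  push_cast
  field_simp
  linear_combination (-conj (S θ) * q.im) * Complex.I_sq

/-- An integral mean bound obtained by integration by parts along the boundary of the image of a
convex function. -/
lemma IsConvexFunction.circleAverage_norm_mul_re_le {f g : ℂ → ℂ} (hf : DifferentiableOn ℂ f disc)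
    (hg : IsConvexFunction g) (hg' : ∀ z ∈ disc, deriv g z ≠ 0) {r : ℝ} (h0 : 0 < r) (hr : r < 1) :
    Real.circleAverage (fun z => ‖z * deriv g z‖ * (deriv f z / deriv g z).re) 0 r ≤
      maxModulus r f := by
  have hgd := deriv_differentiableOn_disc hg.1.1
  have hgdd := deriv_differentiableOn_disc hgd
  have hfd := deriv_differentiableOn_disc hf
  set q : ℂ → ℂ := fun z => 1 + z * (deriv (deriv g) z / deriv g z) with hq
  have hqd : DifferentiableOn ℂ q disc :=
    (differentiableOn_id.mul (hgdd.div hgd hg')).const_add 1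
  have hdd : DifferentiableOn ℂ (fun z => deriv f z / deriv g z) disc := hfd.div hgd hg'
  set s : ℂ → ℂ := fun z => z * deriv g z with hs
  have hsd : DifferentiableOn ℂ s disc := differentiableOn_id.mul hgd
  have hsub := sphere_subset_disc hr
  have hs0 : ∀ z ∈ sphere (0 : ℂ) r, s z ≠ 0 := fun z hz =>
    mul_ne_zero (ne_of_mem_sphere hz h0.ne') (hg' z (hsub hz))
  -- `U` is the conjugate of the unit normal direction `s / |s|` of the image curve, and `i D` is
  -- the derivative of `f U` in the angle, so `D` has mean zero by periodicity.
  set U : ℂ → ℂ := fun z => conj (s z) / (‖s z‖ : ℂ) with hU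
  set D : ℂ → ℂ := fun z => deriv f z / deriv g z * (‖s z‖ : ℂ) - f z * ((q z).re : ℂ) * U z with hD
  have hUc : ContinuousOn U (sphere 0 r) := by
    refine ContinuousOn.div (Complex.continuous_conj.comp_continuousOn (hsd.continuousOn.mono hsub))
      (Complex.continuous_ofReal.comp_continuousOn (hsd.continuousOn.mono hsub).norm) fun z hz => ?_
    exact_mod_cast norm_ne_zero_iff.2 (hs0 z hz)
  have hqre : ContinuousOn (fun z => (q z).re) (sphere 0 r) :=
    Complex.continuous_re.comp_continuousOn (hqd.continuousOn.mono hsub)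
  have hDc : ContinuousOn D (sphere 0 r) := by
    refine ContinuousOn.sub ((hdd.continuousOn.mono hsub).mul
      (Complex.continuous_ofReal.comp_continuousOn (hsd.continuousOn.mono hsub).norm)) ?_
    exact ((hf.continuousOn.mono hsub).mul (Complex.continuous_ofReal.comp_continuousOn hqre)).mul hUc
  have hmem : ∀ θ, circleMap 0 r θ ∈ sphere (0 : ℂ) r := fun θ => circleMap_mem_sphere 0 h0.le θ
  have hder : ∀ θ : ℝ, HasDerivAt (fun t => f (circleMap 0 r t) * U (circleMap 0 r t))
      (Complex.I * D (circleMap 0 r θ)) θ := by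
    intro θ
    set z := circleMap 0 r θ with hz
    have hzd : z ∈ disc := hsub (hmem θ)
    have dz : HasDerivAt (circleMap 0 r) (z * Complex.I) θ := hasDerivAt_circleMap 0 r θ
    have dS : HasDerivAt (fun t => s (circleMap 0 r t)) (Complex.I * q z * s z) θ := by
      have d1 : HasDerivAt s (1 * deriv g z + z * deriv (deriv g) z) z :=
        (hasDerivAt_id z).mul (hasDerivAt_of_mem_disc hgd hzd)
      refine HasDerivAt.congr_deriv (HasDerivAt.comp (h₂ := s) (h := circleMap 0 r) θ d1 dz)
        (Eq.symm ?_)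
      have := hg' z hzd
      simp only [hs, hq]
      field_simp
    have dU : HasDerivAt (fun t => U (circleMap 0 r t)) (-(Complex.I * ((q z).re : ℂ) * U z)) θ :=
      hasDerivAt_conj_div_norm dS (hs0 z (hmem θ))
    have dF : HasDerivAt (fun t => f (circleMap 0 r t)) (deriv f z * (z * Complex.I)) θ :=
      HasDerivAt.comp (h₂ := f) (h := circleMap 0 r) θ (hasDerivAt_of_mem_disc hf hzd) dz
    refine HasDerivAt.congr_deriv (dF.mul dU) (Eq.symm ?_)
    have h1 : z * U z = (‖s z‖ : ℂ) / deriv g z := by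
      have hn : (‖s z‖ : ℂ) ≠ 0 := by exact_mod_cast norm_ne_zero_iff.2 (hs0 z (hmem θ))
      have h2 : s z * conj (s z) = (‖s z‖ : ℂ) ^ 2 := by
        rw [Complex.mul_conj, Complex.normSq_eq_norm_sq]; push_cast; rfl
      have h3 : z = s z / deriv g z := by
        have := hg' z hzd
        simp only [hs]; field_simp
      calc z * U z = s z * conj (s z) / (deriv g z * ‖s z‖) := by
            nth_rewrite 1 [h3]; simp only [hU]; rw [div_mul_div_comm]
        _ = _ := by rw [h2, sq, mul_div_mul_right _ _ hn]
    rw [← hz]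
    simp only [hD]
    linear_combination (-deriv f z * Complex.I) * h1
  have hint : Real.circleAverage D 0 r = 0 := by
    have h1 := intervalIntegral.integral_eq_sub_of_hasDerivAt (a := 0) (b := 2 * Real.pi)
      (fun θ _ => hder θ) (Continuous.intervalIntegrable (continuous_const.mul
        (hDc.comp_continuous (continuous_circleMap 0 r) hmem)) _ _)
    have hper : circleMap 0 r (2 * Real.pi) = circleMap 0 r 0 := by
      simpa using periodic_circleMap 0 r 0
    rw [hper, sub_self, intervalIntegral.integral_const_mul] at h1
    rw [Real.circleAverage_def, (mul_eq_zero.1 h1).resolve_left Complex.I_ne_zero, smul_zero]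
  have hintre : Real.circleAverage (fun z => (D z).re) 0 r = 0 := by
    have := Complex.reCLM.circleAverage_comp_comm (hDc.circleIntegrable h0.le)
    rw [hint, map_zero] at this
    exact this
  have hqavg : Real.circleAverage (fun z => (q z).re) 0 r = 1 := by
    rw [circleAverage_re_of_differentiableOn_disc hqd h0.le hr]
    simp [hq]
  have hDre : ContinuousOn (fun z => (D z).re) (sphere 0 r) :=
    Complex.continuous_re.comp_continuousOn hDc
  have hM : ContinuousOn (fun z => maxModulus r f • (q z).re) (sphere 0 r) := by fun_prop
  -- Since `|U| = 1` and `Re q ≥ 0`, the error term is at most `maxModulus r f * Re q`, and `Re q`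
  -- has mean `1`.
  calc Real.circleAverage (fun z => ‖z * deriv g z‖ * (deriv f z / deriv g z).re) 0 r
      ≤ Real.circleAverage (fun z => (D z).re + maxModulus r f • (q z).re) 0 r := by
        refine Real.circleAverage_mono ?_ ((hDre.add hM).circleIntegrable h0.le) fun z hz => ?_
        · refine circleIntegrable_of_continuousOn_disc ?_ h0.le hr
          exact hsd.continuousOn.norm.mul
            (Complex.continuous_re.comp_continuousOn hdd.continuousOn)
        · rw [abs_of_pos h0] at hz
          have hqn : 0 ≤ (q z).re := hg.re_nonneg hg' (hsub hz)
          have hUn : ‖U z‖ = 1 := by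
            simp only [hU, norm_div, Complex.norm_real, norm_norm, RCLike.norm_conj]
            exact div_self (norm_ne_zero_iff.2 (hs0 z hz))
          have h1 : (f z * ((q z).re : ℂ) * U z).re ≤ maxModulus r f * (q z).re := by
            refine (Complex.re_le_norm _).trans ?_
            rw [norm_mul, norm_mul, hUn, mul_one, Complex.norm_real, Real.norm_of_nonneg hqn]
            gcongr
            exact norm_le_maxModulus_of_mem_sphere hf hr hz
          have h2 : (D z).re = (deriv f z / deriv g z).re * ‖s z‖ -
              (f z * ((q z).re : ℂ) * U z).re := by
            simp only [hD, Complex.sub_re, Complex.re_mul_ofReal]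
          rw [h2, smul_eq_mul, mul_comm]
          linarith
    _ = maxModulus r f := by
        rw [Real.circleAverage_fun_add (hDre.circleIntegrable h0.le) (hM.circleIntegrable h0.le),
          Real.circleAverage_fun_smul, hintre, hqavg]
        simp

/-- An `L¹` bound for the second derivative of a close-to-convex function. -/
lemma circleAverage_norm_deriv_deriv_le {f g : ℂ → ℂ} (hf : DifferentiableOn ℂ f disc)
    (hg : IsConvexFunction g) (h : ∀ z ∈ disc, 0 < (deriv f z / deriv g z).re) {r : ℝ}
    (h0 : 1 / 2 ≤ r) (hr : r < 1) :
    Real.circleAverage (fun z => ‖deriv (deriv f) z‖) 0 r ≤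
      16 / (1 - r) * maxModulus ((1 + r) / 2) f := by
  have hg' : ∀ z ∈ disc, deriv g z ≠ 0 := fun z hz => deriv_ne_zero_of_re_div_pos (h z hz)
  have hgd := deriv_differentiableOn_disc hg.1.1
  have hgdd := deriv_differentiableOn_disc hgd
  have hfd := deriv_differentiableOn_disc hf
  have hfdd := deriv_differentiableOn_disc hfd
  have hr0 : 0 < r := by linarith
  have hd0 : 0 < 1 - r := by linarith
  have hdd : DifferentiableOn ℂ (fun z => deriv f z / deriv g z) disc := hfd.div hgd hg'
  set Q : ℂ → ℂ := fun z => z * (deriv (deriv g) z / deriv g z) with hQ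
  have hQd : DifferentiableOn ℂ Q disc := differentiableOn_id.mul (hgdd.div hgd hg')
  have hQavg := circleAverage_norm_sq_le_of_re_ge hQd (by simp [hQ]) (fun z hz => by
    have := hg.re_nonneg hg' hz
    simp only [Complex.add_re, Complex.one_re] at this
    simp only [hQ]
    linarith) hr0.le hr
  have hsavg := hg.circleAverage_norm_mul_re_le hf hg' hr0 hr
  have hfavg := Univalent.circleAverage_norm_deriv_sq_le
    (mem_univalent_of_closeToConvex hf hg h) h0 hr
  set M := maxModulus ((1 + r) / 2) f with hM
  have hMr : maxModulus r f ≤ M := maxModulus_mono hf (by linarith) (by linarith)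
  -- Strict positivity, from `f' 0 ≠ 0`, allows `M⁻¹` and `M` as balancing weights in the
  -- arithmetic–geometric mean inequality.
  have hM0 : 0 < M := by
    have h1 := norm_coeff_mul_pow_le_maxModulus hf (r := (1 + r) / 2) (by linarith) (by linarith) 1
    refine lt_of_lt_of_le (mul_pos ?_ (by positivity)) h1
    have h2 := coeff_deriv f 0
    simp only [coeff_zero, Nat.cast_zero, zero_add, one_mul] at h2
    rw [← h2, norm_pos_iff]
    intro h3
    have := h 0 zero_mem_disc
    simp [h3] at this
  have hpt : ∀ z ∈ sphere (0 : ℂ) |r|, ‖deriv (deriv f) z‖ ≤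
      (M⁻¹ • ‖deriv f z‖ ^ 2 + M • ‖Q z‖ ^ 2) +
        (4 / (1 - r)) • (‖z * deriv g z‖ * (deriv f z / deriv g z).re) := by
    intro z hz
    rw [abs_of_pos hr0] at hz
    have hzd := sphere_subset_disc hr hz
    have hzn : ‖z‖ = r := mem_sphere_zero_iff_norm.1 hz
    have hgz := hg' z hzd
    have hz0 : z ≠ 0 := ne_of_mem_sphere hz hr0.ne'
    have hSP := norm_deriv_le_of_re_pos hdd h hzd
    rw [hzn] at hSP
    have heq : deriv (deriv f) z = deriv f z * (Q z / z) +
        deriv g z * deriv (fun z => deriv f z / deriv g z) z := by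
      have d := (hasDerivAt_of_mem_disc hfd hzd).div (hasDerivAt_of_mem_disc hgd hzd) hgz
      have d' : deriv (fun z => deriv f z / deriv g z) z = _ := d.deriv
      rw [d']
      simp only [hQ]
      field_simp
      ring
    have e1 : ‖Q z / z‖ ≤ 2 * ‖Q z‖ := by
      rw [norm_div, hzn, div_le_iff₀ hr0]
      nlinarith [norm_nonneg (Q z)]
    have e2 : ‖deriv g z‖ ≤ 2 * ‖z * deriv g z‖ := by
      rw [norm_mul, hzn]
      nlinarith [norm_nonneg (deriv g z)]
    have e3 : 2 * (‖deriv f z‖ * ‖Q z‖) ≤ M⁻¹ * ‖deriv f z‖ ^ 2 + M * ‖Q z‖ ^ 2 := by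
      have e4 : M⁻¹ * ‖deriv f z‖ ^ 2 + M * ‖Q z‖ ^ 2 - 2 * (‖deriv f z‖ * ‖Q z‖) =
          M⁻¹ * (‖deriv f z‖ - M * ‖Q z‖) ^ 2 := by
        field_simp
        ring
      have : 0 ≤ M⁻¹ * (‖deriv f z‖ - M * ‖Q z‖) ^ 2 := by positivity
      linarith
    have hpos := h z hzd
    calc ‖deriv (deriv f) z‖ ≤ ‖deriv f z‖ * ‖Q z / z‖ +
          ‖deriv g z‖ * ‖deriv (fun z => deriv f z / deriv g z) z‖ := by
          rw [heq]
          exact (norm_add_le _ _).trans (by rw [norm_mul, norm_mul])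
      _ ≤ ‖deriv f z‖ * (2 * ‖Q z‖) +
          2 * ‖z * deriv g z‖ * (2 * (deriv f z / deriv g z).re / (1 - r)) := by gcongr
      _ ≤ _ := by
          simp only [smul_eq_mul]
          have e5 : 2 * ‖z * deriv g z‖ * (2 * (deriv f z / deriv g z).re / (1 - r)) =
            4 / (1 - r) * (‖z * deriv g z‖ * (deriv f z / deriv g z).re) := by ring
          rw [e5]
          linarith
  have hc1 : ContinuousOn (fun z => ‖deriv f z‖ ^ 2) disc := hfd.continuousOn.norm.pow 2
  have hc2 : ContinuousOn (fun z => ‖Q z‖ ^ 2) disc := hQd.continuousOn.norm.pow 2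
  have hc3 : ContinuousOn (fun z => ‖z * deriv g z‖ * (deriv f z / deriv g z).re) disc :=
    (differentiableOn_id.mul hgd).continuousOn.norm.mul
      (Complex.continuous_re.comp_continuousOn hdd.continuousOn)
  have hi : ∀ {φ : ℂ → ℝ} (c : ℝ), ContinuousOn φ disc →
      CircleIntegrable (fun z => c • φ z) 0 r := fun c hφ =>
    circleIntegrable_of_continuousOn_disc (by fun_prop) hr0.le hr
  have hi12 := (hi M⁻¹ hc1).add (hi M hc2)
  refine (Real.circleAverage_mono
    (circleIntegrable_of_continuousOn_disc hfdd.continuousOn.norm hr0.le hr)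
    (hi12.add (hi _ hc3)) hpt).trans ?_
  rw [Real.circleAverage_add hi12 (hi (4 / (1 - r)) hc3),
    Real.circleAverage_add (hi M⁻¹ hc1) (hi M hc2), Real.circleAverage_fun_smul, Real.circleAverage_fun_smul,
    Real.circleAverage_fun_smul]
  simp only [smul_eq_mul]
  calc M⁻¹ * Real.circleAverage (fun z => ‖deriv f z‖ ^ 2) 0 r +
        M * Real.circleAverage (fun z => ‖Q z‖ ^ 2) 0 r +
        4 / (1 - r) * Real.circleAverage
          (fun z => ‖z * deriv g z‖ * (deriv f z / deriv g z).re) 0 r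
      -- The contributions are `8` from the area theorem, `4` from the mean of `‖Q‖ ^ 2` and `4`
      -- from Schwarz–Pick.
      ≤ M⁻¹ * (8 / (1 - r) * M ^ 2) + M * (4 / (1 - r)) + 4 / (1 - r) * M := by
        gcongr
        exact hsavg.trans hMr
    _ = 16 / (1 - r) * M := by field_simp; ring

/-- The Clunie–Pommerenke coefficient estimate for close-to-convex functions along dyadic blocks. -/
lemma norm_coeff_le_of_closeToConvex {f : ℂ → ℂ} (hf : f ∈ CloseToConvex) {n k : ℕ}
    (h1 : 2 ^ n ≤ k) (h2 : k < 2 ^ (n + 1)) :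
    ((k : ℝ) + 1) * ‖coeff f k‖ ≤ 512 * maxModulus (dyad (n + 2)) f := by
  obtain ⟨hfd, g, hg, h⟩ := hf
  have hr := half_le_dyad_succ n
  have hr1 := dyad_lt_one (n + 1)
  have hr0 : 0 < dyad (n + 1) := by linarith
  have hk0 : 1 ≤ k := Nat.one_le_two_pow.trans h1
  have hpow : 1 / 4 ≤ dyad (n + 1) ^ k :=
    (dyad_succ_pow_two_pow n).trans (pow_le_pow_of_le_one hr0.le hr1.le h2.le)
  have hM0 := maxModulus_nonneg (dyad (n + 2)) f
  -- The second derivative sees only coefficients of index at least `2`, so `k = 1` is settled by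
  -- Cauchy's estimate.
  rcases hk0.eq_or_lt with rfl | hk
  · have h3 := norm_coeff_mul_pow_le_maxModulus hfd (r := dyad (n + 2))
      (by linarith [half_le_dyad_succ (n + 1)]) (dyad_lt_one _) 1
    have h4 := half_le_dyad_succ (n + 1)
    have h5 := norm_nonneg (coeff f 1)
    push_cast
    rw [pow_one] at h3
    nlinarith
  · obtain ⟨j, rfl⟩ : ∃ j, k = j + 2 := ⟨k - 2, by omega⟩
    have h3 := norm_coeff_mul_pow_le_circleAverage
      (deriv_differentiableOn_disc (deriv_differentiableOn_disc hfd)) hr0 hr1 j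
    have h4 := circleAverage_norm_deriv_deriv_le hfd hg h hr hr1
    rw [one_add_dyad_div_two] at h4
    have h5 : 16 / (1 - dyad (n + 1)) = 16 * 2 ^ (n + 1) := by
      unfold dyad; simp
    rw [h5] at h4
    rw [coeff_deriv, coeff_deriv, norm_mul, norm_mul, norm_natCast_add_one, norm_natCast_add_one]
      at h3
    have h6 : (1 : ℝ) / 4 ≤ dyad (n + 1) ^ j :=
      hpow.trans (pow_le_pow_of_le_one hr0.le hr1.le (by omega))
    have h7 : (2 : ℝ) ^ (n + 1) ≤ 2 * (j + 2) := by
      rw [pow_succ, mul_comm]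
      have : ((2 ^ n : ℕ) : ℝ) ≤ ((j + 2 : ℕ) : ℝ) := by exact_mod_cast h1
      push_cast at this
      linarith
    have h8 : 16 * (2 : ℝ) ^ (n + 1) * maxModulus (dyad (n + 2)) f ≤
        16 * (2 * (j + 2)) * maxModulus (dyad (n + 2)) f := by gcongr
    have h9 := h3.trans (h4.trans h8)
    set A := ‖coeff f (j + 2)‖ with hA
    have hA0 : 0 ≤ A := norm_nonneg _
    push_cast at h9 ⊢
    have h10 : ((j : ℝ) + 1) * ((j + 1 + 1) * A) * (1 / 4) ≤ 32 * (j + 2) * maxModulus (dyad (n + 2)) f := by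
      calc ((j : ℝ) + 1) * ((j + 1 + 1) * A) * (1 / 4)
          ≤ ((j : ℝ) + 1) * ((j + 1 + 1) * A) * dyad (n + 1) ^ j := by gcongr
        _ ≤ _ := by linarith
    have h11 : ((j : ℝ) + 2) * ((j + 1) * A) ≤ (j + 2) * (128 * maxModulus (dyad (n + 2)) f) := by
      linarith
    have h12 := le_of_mul_le_mul_left h11 (by positivity)
    have hj : (0 : ℝ) ≤ j := Nat.cast_nonneg j
    nlinarith [mul_nonneg hj hA0]

/-! ### Comparison of `J` with the coefficient sum -/

lemma tsum_mul_rpow_le {p : ℝ} (hp : 1 ≤ p) (v x : ℕ → ℝ≥0∞) :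
    (∑' k, v k * x k) ^ p ≤ (∑' k, v k) ^ (p - 1) * ∑' k, v k * x k ^ p := by
  have hp0 : 0 < p := by linarith
  have h1 : ∑' k, v k * x k ≤ (∑' k, v k) ^ (1 - p⁻¹) * (∑' k, v k * x k ^ p) ^ p⁻¹ := by
    refine ENNReal.tsum_le_of_sum_range_le fun n => ?_
    refine (ENNReal.inner_le_weight_mul_Lp_of_nonneg _ hp v x).trans ?_
    have : 0 ≤ 1 - p⁻¹ := sub_nonneg.2 (inv_le_one_of_one_le₀ hp)
    gcongr
    · exact ENNReal.sum_le_tsum _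
    · exact ENNReal.sum_le_tsum _
  refine (ENNReal.rpow_le_rpow h1 hp0.le).trans_eq ?_
  rw [ENNReal.mul_rpow_of_nonneg _ _ hp0.le, ← ENNReal.rpow_mul, ← ENNReal.rpow_mul,
    inv_mul_cancel₀ hp0.ne', ENNReal.rpow_one, sub_mul, inv_mul_cancel₀ hp0.ne', one_mul]

/-- Bernoulli's inequality bounds each term by the increment of `N ^ δ / δ`. -/
lemma sum_range_rpow_sub_one_le {δ : ℝ} (h0 : 0 < δ) (h1 : δ ≤ 1) (N : ℕ) :
    ∑ k ∈ Finset.range N, ((k : ℝ) + 1) ^ (δ - 1) ≤ (N : ℝ) ^ δ / δ := by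
  induction N with
  | zero => simp [Real.zero_rpow h0.ne']
  | succ N ih =>
    rw [Finset.sum_range_succ]
    have hN : (0 : ℝ) < (N : ℝ) + 1 := by positivity
    have hb := rpow_one_add_le_one_add_mul_self (s := -(1 / ((N : ℝ) + 1)))
      (by rw [neg_le_neg_iff, div_le_one hN]; linarith [(Nat.cast_nonneg N : (0 : ℝ) ≤ N)]) h0.le h1
    have h2 : 1 + -(1 / ((N : ℝ) + 1)) = N / (N + 1) := by field_simp; ring
    rw [h2, Real.div_rpow (Nat.cast_nonneg N) hN.le, div_le_iff₀ (Real.rpow_pos_of_pos hN _)] at hb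
    have h3 : ((N : ℝ) + 1) ^ (δ - 1) = ((N : ℝ) + 1) ^ δ / (N + 1) := by
      rw [Real.rpow_sub_one hN.ne']
    push_cast
    rw [h3]
    refine (add_le_add_left ih _).trans ?_
    rw [div_add_div _ _ h0.ne' hN.ne', div_le_div_iff₀ (by positivity) h0]
    have h4 : (1 + δ * -(1 / ((N : ℝ) + 1))) * (N + 1) = (N + 1) - δ := by field_simp; ring
    have h5 : (N : ℝ) ^ δ * (N + 1) ≤ (N + 1 - δ) * ((N : ℝ) + 1) ^ δ := by
      rw [← h4]; nlinarith
    nlinarith [mul_le_mul_of_nonneg_left h5 h0.le]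

lemma tsum_rpow_mul_pow_le {δ : ℝ} (h0 : 0 < δ) (h1 : δ ≤ 1) {r : ℝ} (hr0 : 0 ≤ r) (hr1 : r < 1) :
    ∑' k : ℕ, ENNReal.ofReal (((k : ℝ) + 1) ^ (δ - 1) * r ^ k) ≤
      ENNReal.ofReal ((2 / δ + 1) * (1 - r) ^ (-δ)) := by
  have hd : 0 < 1 - r := by linarith
  refine ENNReal.tsum_le_of_sum_range_le fun m => ?_
  rw [← ENNReal.ofReal_sum_of_nonneg (fun k _ => by positivity)]
  refine ENNReal.ofReal_le_ofReal ?_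
  -- Below `N` the factor `r ^ k` is dropped; from `N` on the power of `k + 1` is frozen at `(1 - r)
  -- ^ (1 - δ)` and a geometric series remains.
  set N := ⌈(1 - r)⁻¹⌉₊ with hN
  have hN1 : (1 - r)⁻¹ ≤ N := Nat.le_ceil _
  have hN2 : (N : ℝ) ≤ 2 * (1 - r)⁻¹ := by
    have := Nat.ceil_lt_add_one (inv_nonneg.2 hd.le)
    have h2 : 1 ≤ (1 - r)⁻¹ := one_le_inv₀ hd |>.2 (by linarith)
    linarith
  have hterm : ∀ k : ℕ, ((k : ℝ) + 1) ^ (δ - 1) * r ^ k ≤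
      (if k < N then ((k : ℝ) + 1) ^ (δ - 1) else 0) + (1 - r) ^ (1 - δ) * r ^ k := by
    intro k
    have hp1 : 0 ≤ ((k : ℝ) + 1) ^ (δ - 1) := by positivity
    have hp2 : 0 ≤ (1 - r) ^ (1 - δ) * r ^ k := by positivity
    split_ifs with hk
    · have : r ^ k ≤ 1 := pow_le_one₀ hr0 hr1.le
      nlinarith
    · rw [zero_add]
      gcongr
      have h3 : (1 - r)⁻¹ ≤ (k : ℝ) + 1 := by
        have : (N : ℝ) ≤ k := by exact_mod_cast not_lt.1 hk
        linarith
      calc ((k : ℝ) + 1) ^ (δ - 1) ≤ ((1 - r)⁻¹) ^ (δ - 1) :=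
            Real.rpow_le_rpow_of_nonpos (by positivity) h3 (by linarith)
        _ = (1 - r) ^ (1 - δ) := by
            rw [Real.inv_rpow hd.le, ← Real.rpow_neg hd.le, neg_sub]
  refine (Finset.sum_le_sum fun k _ => hterm k).trans ?_
  rw [Finset.sum_add_distrib, ← Finset.mul_sum, add_mul, one_mul]
  refine add_le_add ?_ ?_
  · calc ∑ k ∈ Finset.range m, (if k < N then ((k : ℝ) + 1) ^ (δ - 1) else 0)
        ≤ ∑ k ∈ Finset.range N, ((k : ℝ) + 1) ^ (δ - 1) := by
          rw [← Finset.sum_filter]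
          refine Finset.sum_le_sum_of_subset_of_nonneg (fun k hk => ?_) fun k _ _ => by positivity
          exact Finset.mem_range.2 (Finset.mem_filter.1 hk).2
      _ ≤ (N : ℝ) ^ δ / δ := sum_range_rpow_sub_one_le h0 h1 N
      _ ≤ (2 * (1 - r) ^ (-δ)) / δ := by
          gcongr
          calc (N : ℝ) ^ δ ≤ (2 * (1 - r)⁻¹) ^ δ := by gcongr
            _ = 2 ^ δ * (1 - r) ^ (-δ) := by
                rw [Real.mul_rpow (by norm_num) (by positivity), Real.inv_rpow hd.le,
                  Real.rpow_neg hd.le]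
            _ ≤ 2 * (1 - r) ^ (-δ) := by
                gcongr
                exact (Real.rpow_le_rpow_of_exponent_le one_le_two h1).trans (by simp)
      _ = 2 / δ * (1 - r) ^ (-δ) := by ring
  · have h3 : ∑ k ∈ Finset.range m, r ^ k ≤ (1 - r)⁻¹ := by
      rw [← tsum_geometric_of_lt_one hr0 hr1]
      exact (summable_geometric_of_lt_one hr0 hr1).sum_le_tsum _ fun k _ => by positivity
    calc (1 - r) ^ (1 - δ) * ∑ k ∈ Finset.range m, r ^ k ≤ (1 - r) ^ (1 - δ) * (1 - r)⁻¹ := by gcongr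
      _ = (1 - r) ^ (-δ) := by
          rw [← Real.rpow_neg_one, ← Real.rpow_add hd]; congr 1; ring

lemma J_eq_lintegral (p : ℝ) (ω : ℂ → ℝ) (f : ℂ → ℂ) :
    J p ω f = ∫⁻ r in Ioo (0 : ℝ) 1, ENNReal.ofReal (maxModulus r f ^ p) *
      ENNReal.ofReal (ω (r : ℂ)) := by
  unfold J
  refine lintegral_congr fun r => ?_
  rw [ENNReal.ofReal_mul (Real.rpow_nonneg (maxModulus_nonneg _ _) _)]

lemma coeffSum_term_eq (p : ℝ) (ω : ℂ → ℝ) (f : ℂ → ℂ) (k : ℕ) :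
    ENNReal.ofReal (‖coeff f k‖ ^ p * ((k : ℝ) + 1) ^ (p - 1) * moment ω (k : ℝ)) =
      ENNReal.ofReal (‖coeff f k‖ ^ p * ((k : ℝ) + 1) ^ (p - 1)) * ENNReal.ofReal (moment ω k) :=
  ENNReal.ofReal_mul (by positivity)

/-- For a doubling weight, `J` is dominated by the coefficient sum for every analytic function. -/
lemma IsDoublingWeight.exists_J_le {ω : ℂ → ℝ} (hω : IsDoublingWeight ω) {p : ℝ} (hp : 1 ≤ p) :
    ∃ C : ℝ≥0∞, C ≠ ⊤ ∧ ∀ f : ℂ → ℂ, DifferentiableOn ℂ f disc →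
      J p ω f ≤ C * coeffSum p ω f := by
  obtain ⟨η₀, hη0, hη1, D, hD, hint⟩ := hω.exists_lintegral_rpow_mul_pow_le
  obtain ⟨E, hE, hmom⟩ := hω.exists_tail_le_moment
  have hp0 : 0 < p := by linarith
  -- Hölder's inequality produces `(1 - r) ^ (-δ (p - 1))`, and this choice keeps `δ (p - 1) ≤ η₀`.
  set δ : ℝ := η₀ / p with hδ
  have hδ0 : 0 < δ := by positivity
  have hδη : δ ≤ η₀ := div_le_self hη0.le hp
  have hδ1 : δ ≤ 1 := hδη.trans hη1
  set η : ℝ := δ * (p - 1) with hη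
  have hη' : 0 ≤ η := mul_nonneg hδ0.le (by linarith)
  have hηη : η ≤ η₀ := by
    have : δ * p = η₀ := by rw [hδ]; field_simp
    rw [hη]; nlinarith
  set A : ℝ := 2 / δ + 1 with hA
  have hA0 : 0 < A := by positivity
  have hB : ENNReal.ofReal (A ^ (p - 1)) ≠ ⊤ := ENNReal.ofReal_ne_top
  refine ⟨ENNReal.ofReal (A ^ (p - 1)) * (D * E), ENNReal.mul_ne_top hB (ENNReal.mul_ne_top hD hE),
    fun f hf => ?_⟩
  have hWm : AEMeasurable (fun r : ℝ => ENNReal.ofReal (ω (r : ℂ)))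
      (volume.restrict (Ioo (0 : ℝ) 1)) :=
    hω.weight.integrable.aestronglyMeasurable.aemeasurable.ennreal_ofReal
  set c : ℕ → ℝ := fun k => ‖coeff f k‖ ^ p * ((k : ℝ) + 1) ^ ((1 - δ) * (p - 1)) with hc
  have hc0 : ∀ k, 0 ≤ c k := fun k => by positivity
  have hpt : ∀ r ∈ Ioo (0 : ℝ) 1, ENNReal.ofReal (maxModulus r f ^ p) ≤
      ENNReal.ofReal (A ^ (p - 1)) *
        ∑' k : ℕ, ENNReal.ofReal (c k) * ENNReal.ofReal ((1 - r) ^ (-η) * r ^ k) := by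
    intro r hr
    have hd : 0 < 1 - r := by linarith [hr.2]
    set v : ℕ → ℝ := fun k => ((k : ℝ) + 1) ^ (δ - 1) * r ^ k with hv
    set x : ℕ → ℝ := fun k => ‖coeff f k‖ * ((k : ℝ) + 1) ^ (1 - δ) with hx
    have hr0 := hr.1.le
    have hv0 : ∀ k, 0 ≤ v k := fun k => by positivity
    have hx0 : ∀ k, 0 ≤ x k := fun k => by positivity
    have h1 : ENNReal.ofReal (maxModulus r f) ≤
        ∑' k, ENNReal.ofReal (v k) * ENNReal.ofReal (x k) := by
      refine (ENNReal.ofReal_le_ofReal (maxModulus_le_tsum hf hr0 hr.2)).trans_eq ?_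
      rw [ENNReal.ofReal_tsum_of_nonneg (fun k => by positivity) (summable_norm_coeff hf hr0 hr.2)]
      refine tsum_congr fun k => ?_
      rw [← ENNReal.ofReal_mul (hv0 k)]
      congr 1
      have hk : (0 : ℝ) < (k : ℝ) + 1 := by positivity
      have : ((k : ℝ) + 1) ^ (δ - 1) * ((k : ℝ) + 1) ^ (1 - δ) = 1 := by
        rw [← Real.rpow_add hk]; simp
      simp only [hv, hx]
      linear_combination (-‖coeff f k‖ * r ^ k) * this
    rw [← ENNReal.ofReal_rpow_of_nonneg (maxModulus_nonneg _ _) hp0.le]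
    refine (ENNReal.rpow_le_rpow h1 hp0.le).trans ((tsum_mul_rpow_le hp _ _).trans ?_)
    have h2 := ENNReal.rpow_le_rpow (tsum_rpow_mul_pow_le hδ0 hδ1 hr0 hr.2)
      (by linarith : 0 ≤ p - 1)
    refine (mul_le_mul' h2 le_rfl).trans_eq ?_
    rw [ENNReal.ofReal_rpow_of_nonneg (by positivity) (by linarith),
      Real.mul_rpow hA0.le (by positivity), ← Real.rpow_mul hd.le,
      ENNReal.ofReal_mul (by positivity), mul_assoc, ← ENNReal.tsum_mul_left]
    congr 1
    refine tsum_congr fun k => ?_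
    rw [ENNReal.ofReal_rpow_of_nonneg (hx0 k) hp0.le, ← ENNReal.ofReal_mul (hv0 k),
      ← ENNReal.ofReal_mul (by positivity), ← ENNReal.ofReal_mul (hc0 k)]
    congr 1
    have hk : (0 : ℝ) < (k : ℝ) + 1 := by positivity
    have e1 : x k ^ p = ‖coeff f k‖ ^ p * ((k : ℝ) + 1) ^ ((1 - δ) * p) := by
      simp only [hx]
      rw [Real.mul_rpow (norm_nonneg _) (by positivity), ← Real.rpow_mul hk.le]
    have e2 : ((k : ℝ) + 1) ^ ((1 - δ) * (p - 1)) =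
        ((k : ℝ) + 1) ^ (δ - 1) * ((k : ℝ) + 1) ^ ((1 - δ) * p) := by
      rw [← Real.rpow_add hk]; congr 1; ring
    have e3 : -δ * (p - 1) = -η := by rw [hη]; ring
    simp only [hc, hv, e1, e2, e3]
    ring
  rw [J_eq_lintegral]
  calc ∫⁻ r in Ioo (0 : ℝ) 1, ENNReal.ofReal (maxModulus r f ^ p) * ENNReal.ofReal (ω (r : ℂ))
      ≤ ∫⁻ r in Ioo (0 : ℝ) 1, ENNReal.ofReal (A ^ (p - 1)) * ∑' k : ℕ, ENNReal.ofReal (c k) *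
          (ENNReal.ofReal ((1 - r) ^ (-η) * r ^ k) * ENNReal.ofReal (ω (r : ℂ))) := by
        refine lintegral_mono_ae ((ae_restrict_iff' measurableSet_Ioo).2 (ae_of_all _ fun r hr => ?_))
        refine (mul_le_mul' (hpt r hr) le_rfl).trans_eq ?_
        rw [mul_assoc, ← ENNReal.tsum_mul_right]
        simp only [mul_assoc]
    _ = ENNReal.ofReal (A ^ (p - 1)) * ∑' k : ℕ, ENNReal.ofReal (c k) *
          ∫⁻ r in Ioo (0 : ℝ) 1,
            ENNReal.ofReal ((1 - r) ^ (-η) * r ^ k) * ENNReal.ofReal (ω (r : ℂ)) := by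
        rw [lintegral_const_mul' _ _ hB, lintegral_tsum]
        · congr 1
          exact tsum_congr fun k => lintegral_const_mul' _ _ ENNReal.ofReal_ne_top
        · intro k
          have : Measurable fun r : ℝ => ENNReal.ofReal ((1 - r) ^ (-η) * r ^ k) := by fun_prop
          exact (this.aemeasurable.mul hWm).const_mul _
    _ ≤ ENNReal.ofReal (A ^ (p - 1)) * ∑' k : ℕ, D * E *
          ENNReal.ofReal (‖coeff f k‖ ^ p * ((k : ℝ) + 1) ^ (p - 1) * moment ω (k : ℝ)) := by
        refine mul_le_mul' le_rfl (ENNReal.tsum_le_tsum fun k => ?_)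
        set n := Nat.log 2 (k + 1) with hn
        have hn1 : 2 ^ n ≤ k + 1 := Nat.pow_log_le_self 2 k.succ_ne_zero
        have hn2 : k + 1 ≤ 2 ^ (n + 1) := (Nat.lt_pow_succ_log_self one_lt_two _).le
        have hk : (0 : ℝ) < (k : ℝ) + 1 := by positivity
        have h2n : ((2 : ℝ) ^ n) ^ η ≤ ((k : ℝ) + 1) ^ η := by
          refine Real.rpow_le_rpow (by positivity) ?_ hη'
          exact_mod_cast hn1
        have e1 : ((k : ℝ) + 1) ^ (p - 1) =
            ((k : ℝ) + 1) ^ ((1 - δ) * (p - 1)) * ((k : ℝ) + 1) ^ η := by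
          rw [← Real.rpow_add hk]; congr 1; rw [hη]; ring
        calc ENNReal.ofReal (c k) * ∫⁻ r in Ioo (0 : ℝ) 1,
              ENNReal.ofReal ((1 - r) ^ (-η) * r ^ k) * ENNReal.ofReal (ω (r : ℂ))
            ≤ ENNReal.ofReal (c k) * (D * (ENNReal.ofReal (((k : ℝ) + 1) ^ η) *
                (E * ENNReal.ofReal (moment ω k)))) := by
              refine mul_le_mul' le_rfl ((hint η hη' hηη n k hn1).trans ?_)
              rw [ENNReal.ofReal_mul (by positivity)]
              gcongr
              exact hmom n k hn2
          _ = D * E * (ENNReal.ofReal (c k) * ENNReal.ofReal (((k : ℝ) + 1) ^ η) *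
                ENNReal.ofReal (moment ω k)) := by ring
          _ = _ := by
              rw [coeffSum_term_eq, ← ENNReal.ofReal_mul (hc0 k), e1, ← mul_assoc (‖coeff f k‖ ^ p)]
    _ = _ := by
        rw [ENNReal.tsum_mul_left, ← mul_assoc]
        rfl

/-! ### Dyadic blocks of coefficients -/

lemma tsum_le_add_tsum_sum_Ico_two_pow (F : ℕ → ℝ≥0∞) :
    ∑' k, F k ≤ F 0 + ∑' n, ∑ k ∈ Finset.Ico (2 ^ n) (2 ^ (n + 1)), F k := by
  have h : ∀ n, ∑ k ∈ Finset.range (2 ^ n), F k =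
      F 0 + ∑ j ∈ Finset.range n, ∑ k ∈ Finset.Ico (2 ^ j) (2 ^ (j + 1)), F k := by
    intro n
    induction n with
    | zero => simp
    | succ n ih =>
      rw [Finset.sum_range_succ, ← add_assoc, ← ih, Finset.sum_range_add_sum_Ico]
      exact Nat.pow_le_pow_right two_pos (Nat.le_succ n)
  refine ENNReal.tsum_le_of_sum_range_le fun n => ?_
  refine (Finset.sum_le_sum_of_subset (Finset.range_mono Nat.lt_two_pow_self.le)).trans ?_
  rw [h]
  gcongr
  exact ENNReal.sum_le_tsum _

/-- For a doubling weight, a bound on the coefficients over dyadic blocks by the maximum modulus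
yields domination of the coefficient sum by `J`. -/
lemma IsDoublingWeight.exists_coeffSum_le {ω : ℂ → ℝ} (hω : IsDoublingWeight ω) {p : ℝ} (hp : 1 ≤ p)
    {S : Set (ℂ → ℂ)} (hS : ∀ f ∈ S, DifferentiableOn ℂ f disc) {B : ℝ} (hB : 0 ≤ B)
    (hblock : ∀ f ∈ S, ∀ n : ℕ, ∑ k ∈ Finset.Ico (2 ^ n) (2 ^ (n + 1)),
      ‖coeff f k‖ ^ p * ((k : ℝ) + 1) ^ (p - 1) ≤ B * maxModulus (dyad (n + 2)) f ^ p) :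
    ∃ C : ℝ≥0∞, C ≠ ⊤ ∧ ∀ f ∈ S, coeffSum p ω f ≤ C * J p ω f := by
  obtain ⟨η₀, hη0, -, D, hD, hint⟩ := hω.exists_lintegral_rpow_mul_pow_le
  obtain ⟨E, hE, hdis⟩ := hω.exists_tsum_mul_tail_le 2
  have hp0 : 0 < p := by linarith
  refine ⟨1 + D * ENNReal.ofReal B * E, ENNReal.add_ne_top.2 ⟨ENNReal.one_ne_top,
    ENNReal.mul_ne_top (ENNReal.mul_ne_top hD ENNReal.ofReal_ne_top) hE⟩, fun f hf => ?_⟩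
  have hfd := hS f hf
  have hmom : ∀ n k : ℕ, 2 ^ n ≤ k → ENNReal.ofReal (moment ω k) ≤
      D * ENNReal.ofReal (tail ω (dyad n)) := by
    intro n k hk
    -- The case `η = 0` of the integral estimate is the upper bound for moments by tails.
    have := hint 0 le_rfl hη0.le n k (by omega)
    simp only [neg_zero, Real.rpow_zero, one_mul] at this
    rwa [← hω.weight.ofReal_moment] at this
  set G : ℝ → ℝ≥0∞ := fun r => ENNReal.ofReal (maxModulus r f ^ p) with hG
  have hGm : MonotoneOn G (Ico 0 1) := fun r hr s hs hrs => by
    refine ENNReal.ofReal_le_ofReal ?_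
    exact Real.rpow_le_rpow (maxModulus_nonneg _ _) (maxModulus_mono hfd hrs hs.2) hp0.le
  refine (tsum_le_add_tsum_sum_Ico_two_pow _).trans ?_
  rw [add_mul, one_mul]
  refine add_le_add ?_ ?_
  · rw [coeffSum_term_eq, hω.weight.ofReal_moment, J_eq_lintegral,
      ← lintegral_const_mul' _ _ ENNReal.ofReal_ne_top]
    refine lintegral_mono_ae ((ae_restrict_iff' measurableSet_Ioo).2 (ae_of_all _ fun r hr => ?_))
    simp only [CharP.cast_eq_zero, zero_add, Real.one_rpow, mul_one, pow_zero, ENNReal.ofReal_one,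
      one_mul]
    gcongr
    rw [coeff_zero]
    exact norm_le_maxModulus hfd hr.2 (by simpa using hr.1.le)
  · calc ∑' n : ℕ, ∑ k ∈ Finset.Ico (2 ^ n) (2 ^ (n + 1)),
          ENNReal.ofReal (‖coeff f k‖ ^ p * ((k : ℝ) + 1) ^ (p - 1) * moment ω (k : ℝ))
        ≤ ∑' n : ℕ, D * ENNReal.ofReal B * (G (dyad (n + 2)) * ENNReal.ofReal (tail ω (dyad n))) := by
          refine ENNReal.tsum_le_tsum fun n => ?_
          calc ∑ k ∈ Finset.Ico (2 ^ n) (2 ^ (n + 1)),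
                ENNReal.ofReal (‖coeff f k‖ ^ p * ((k : ℝ) + 1) ^ (p - 1) * moment ω (k : ℝ))
              ≤ ∑ k ∈ Finset.Ico (2 ^ n) (2 ^ (n + 1)),
                ENNReal.ofReal (‖coeff f k‖ ^ p * ((k : ℝ) + 1) ^ (p - 1)) *
                  (D * ENNReal.ofReal (tail ω (dyad n))) := by
                refine Finset.sum_le_sum fun k hk => ?_
                rw [coeffSum_term_eq]
                gcongr
                exact hmom n k (Finset.mem_Ico.1 hk).1
            _ = ENNReal.ofReal (∑ k ∈ Finset.Ico (2 ^ n) (2 ^ (n + 1)),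
                  ‖coeff f k‖ ^ p * ((k : ℝ) + 1) ^ (p - 1)) *
                  (D * ENNReal.ofReal (tail ω (dyad n))) := by
                rw [← Finset.sum_mul, ENNReal.ofReal_sum_of_nonneg fun k _ => by positivity]
            _ ≤ ENNReal.ofReal (B * maxModulus (dyad (n + 2)) f ^ p) *
                  (D * ENNReal.ofReal (tail ω (dyad n))) := by
                gcongr
                exact hblock f hf n
            _ = _ := by rw [ENNReal.ofReal_mul hB]; ring
      _ = D * ENNReal.ofReal B * ∑' n : ℕ, G (dyad (n + 2)) * ENNReal.ofReal (tail ω (dyad n)) :=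
          ENNReal.tsum_mul_left
      _ ≤ D * ENNReal.ofReal B * (E * J p ω f) := by
          rw [J_eq_lintegral]
          exact mul_le_mul' le_rfl (hdis G hGm)
      _ = _ := by ring

/-- Exhibits a block sum as an `ℓ^p` sum of `(k + 1) |a_k|` for the weights `1 / (k + 1)`, of total
mass at most `1` on a block. -/
lemma norm_rpow_mul_rpow_sub_one_eq {p : ℝ} (a : ℂ) (k : ℕ) :
    ‖a‖ ^ p * ((k : ℝ) + 1) ^ (p - 1) = ((k : ℝ) + 1)⁻¹ * (((k : ℝ) + 1) * ‖a‖) ^ p := by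
  have hk : (0 : ℝ) < (k : ℝ) + 1 := by positivity
  rw [Real.mul_rpow hk.le (norm_nonneg _), Real.rpow_sub_one hk.ne']
  field_simp

lemma sum_Ico_two_pow_inv_le_one (n : ℕ) :
    ∑ k ∈ (Finset.Ico (2 ^ n) (2 ^ (n + 1)) : Finset ℕ), ((k : ℝ) + 1)⁻¹ ≤ 1 := by
  have h : ∀ k ∈ (Finset.Ico (2 ^ n) (2 ^ (n + 1)) : Finset ℕ), ((k : ℝ) + 1)⁻¹ ≤ ((2 : ℝ) ^ n)⁻¹ := by
    intro k hk
    have : (2 : ℝ) ^ n ≤ k := by exact_mod_cast (Finset.mem_Ico.1 hk).1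
    gcongr
    linarith
  refine (Finset.sum_le_card_nsmul _ _ _ h).trans ?_
  rw [Nat.card_Ico, pow_succ, show 2 ^ n * 2 - 2 ^ n = 2 ^ n by omega, nsmul_eq_mul]
  push_cast
  exact (mul_inv_cancel₀ (by positivity)).le

lemma closeToConvex_sum_block_le {p : ℝ} (hp : 1 ≤ p) {f : ℂ → ℂ} (hf : f ∈ CloseToConvex) (n : ℕ) :
    ∑ k ∈ Finset.Ico (2 ^ n) (2 ^ (n + 1)), ‖coeff f k‖ ^ p * ((k : ℝ) + 1) ^ (p - 1) ≤
      512 ^ p * maxModulus (dyad (n + 2)) f ^ p := by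
  have hM := maxModulus_nonneg (dyad (n + 2)) f
  simp only [norm_rpow_mul_rpow_sub_one_eq]
  rw [← Real.mul_rpow (by norm_num) hM]
  calc _ ≤ ∑ k ∈ (Finset.Ico (2 ^ n) (2 ^ (n + 1)) : Finset ℕ), ((k : ℝ) + 1)⁻¹ *
        (512 * maxModulus (dyad (n + 2)) f) ^ p := by
        refine Finset.sum_le_sum fun k hk => ?_
        have hk' := Finset.mem_Ico.1 hk
        refine mul_le_mul_of_nonneg_left (Real.rpow_le_rpow (by positivity) ?_ (by linarith))
          (by positivity)
        exact norm_coeff_le_of_closeToConvex hf hk'.1 hk'.2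
    _ ≤ _ := by
        rw [← Finset.sum_mul]
        exact mul_le_of_le_one_left (by positivity) (sum_Ico_two_pow_inv_le_one n)

/-- Hölder's inequality with exponent `2 / p ≥ 1` for the weights `1 / (k + 1)` reduces to square
sums, which the area theorem controls. The `32` is `2` from `k + 1 ≤ 2 k` times `16` from `R ^ (2 k)
≥ 1 / 16`. -/
lemma univalent_sum_block_le {p : ℝ} (hp : 1 ≤ p) (hp2 : p ≤ 2) {f : ℂ → ℂ} (hf : f ∈ Univalent)
    (n : ℕ) :
    ∑ k ∈ Finset.Ico (2 ^ n) (2 ^ (n + 1)), ‖coeff f k‖ ^ p * ((k : ℝ) + 1) ^ (p - 1) ≤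
      32 * maxModulus (dyad (n + 2)) f ^ p := by
  have hp0 : 0 < p := by linarith
  set R := dyad (n + 2) with hR
  set M := maxModulus R f with hM
  have hM0 : 0 ≤ M := maxModulus_nonneg R f
  have hR0 : 0 ≤ R := dyad_nonneg _
  set I := Finset.Ico (2 ^ n) (2 ^ (n + 1)) with hI
  have harea : ∑ k ∈ I, (k : ℝ) * ‖coeff f k‖ ^ 2 * R ^ (2 * k) ≤ M ^ 2 := by
    refine le_trans ?_ (Univalent.sum_mul_norm_coeff_sq_le hf hR0 (dyad_lt_one _) (2 ^ (n + 1)))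
    have h1 := Finset.sum_range_succ' (fun k : ℕ => (k : ℝ) * ‖coeff f k‖ ^ 2 * R ^ (2 * k))
      (2 ^ (n + 1))
    simp only [CharP.cast_eq_zero, zero_mul, add_zero, Nat.cast_add, Nat.cast_one] at h1
    rw [← h1]
    refine Finset.sum_le_sum_of_subset_of_nonneg (fun k hk => ?_) fun k _ _ => by positivity
    have := (Finset.mem_Ico.1 hk).2
    exact Finset.mem_range.2 (by omega)
  have hsq : ∑ k ∈ I, ((k : ℝ) + 1)⁻¹ * (((k : ℝ) + 1) * ‖coeff f k‖) ^ 2 ≤ 32 * M ^ 2 := by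
    refine le_trans ?_ (mul_le_mul_of_nonneg_left harea (by norm_num))
    rw [Finset.mul_sum]
    refine Finset.sum_le_sum fun k hk => ?_
    have hk' := Finset.mem_Ico.1 hk
    have hk1 : (1 : ℝ) ≤ k := by exact_mod_cast Nat.one_le_two_pow.trans hk'.1
    have h1 : 1 / 4 ≤ R ^ k := by
      refine (dyad_succ_pow_two_pow n).trans ?_
      refine (pow_le_pow_of_le_one (dyad_nonneg _) (dyad_lt_one _).le hk'.2.le).trans ?_
      exact pow_le_pow_left₀ (dyad_nonneg _) (dyad_mono (Nat.le_succ _)) _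
    have h2 : 1 / 16 ≤ R ^ (2 * k) := by
      rw [mul_comm, pow_mul]; nlinarith
    have h3 : ((k : ℝ) + 1)⁻¹ * (((k : ℝ) + 1) * ‖coeff f k‖) ^ 2 = ((k : ℝ) + 1) * ‖coeff f k‖ ^ 2 := by
      field_simp
    rw [h3]
    have h4 := sq_nonneg ‖coeff f k‖
    calc ((k : ℝ) + 1) * ‖coeff f k‖ ^ 2 ≤ (2 * k) * ‖coeff f k‖ ^ 2 := by gcongr; linarith
      _ = 32 * (k * ‖coeff f k‖ ^ 2 * (1 / 16)) := by ring
      _ ≤ 32 * (k * ‖coeff f k‖ ^ 2 * R ^ (2 * k)) := by gcongr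
  simp only [norm_rpow_mul_rpow_sub_one_eq]
  have hs : 1 ≤ 2 / p := by rw [le_div_iff₀ hp0]; linarith
  have hH := Real.inner_le_weight_mul_Lp_of_nonneg I hs (fun k : ℕ => ((k : ℝ) + 1)⁻¹)
    (fun k => (((k : ℝ) + 1) * ‖coeff f k‖) ^ p) (fun k => by positivity) (fun k => by positivity)
  refine hH.trans ?_
  have e1 : ∀ k : ℕ, ((((k : ℝ) + 1) * ‖coeff f k‖) ^ p) ^ (2 / p) =
      (((k : ℝ) + 1) * ‖coeff f k‖) ^ 2 := by
    intro k
    rw [← Real.rpow_mul (by positivity), mul_div_cancel₀ _ hp0.ne', Real.rpow_two]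
  simp only [e1, inv_div]
  have e2 : (∑ k ∈ I, ((k : ℝ) + 1)⁻¹) ^ (1 - p / 2) ≤ 1 :=
    Real.rpow_le_one (Finset.sum_nonneg fun k _ => by positivity) (sum_Ico_two_pow_inv_le_one n)
      (by linarith)
  have e3 : (∑ k ∈ I, ((k : ℝ) + 1)⁻¹ * (((k : ℝ) + 1) * ‖coeff f k‖) ^ 2) ^ (p / 2) ≤
      32 * M ^ p := by
    calc _ ≤ (32 * M ^ 2) ^ (p / 2) :=
          Real.rpow_le_rpow (Finset.sum_nonneg fun k _ => by positivity) hsq (by positivity)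
      _ = 32 ^ (p / 2) * M ^ p := by
          rw [Real.mul_rpow (by norm_num) (by positivity), ← Real.rpow_two, ← Real.rpow_mul hM0,
            mul_div_cancel₀ _ two_ne_zero]
      _ ≤ 32 * M ^ p := by
          gcongr
          exact (Real.rpow_le_rpow_of_exponent_le (by norm_num) (by linarith)).trans
            (Real.rpow_one 32).le
  calc _ ≤ 1 * (32 * M ^ p) := mul_le_mul e2 e3 (by positivity) zero_le_one
    _ = _ := one_mul _

lemma exists_nnreal_pos_of_ne_top {S : Set (ℂ → ℂ)} {A B : (ℂ → ℂ) → ℝ≥0∞}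
    (h : ∃ C : ℝ≥0∞, C ≠ ⊤ ∧ ∀ f ∈ S, A f ≤ C * B f) :
    ∃ C : ℝ≥0, 0 < C ∧ ∀ f ∈ S, A f ≤ C * B f := by
  obtain ⟨C, hC, hf⟩ := h
  refine ⟨C.toNNReal + 1, by positivity, fun f hfS => (hf f hfS).trans ?_⟩
  gcongr
  rw [ENNReal.coe_add, ENNReal.coe_toNNReal hC]
  exact le_self_add

lemma IsDoublingWeight.comparableOn {ω : ℂ → ℝ} (hω : IsDoublingWeight ω) {p : ℝ} (hp : 1 ≤ p)
    {S : Set (ℂ → ℂ)} (hS : ∀ f ∈ S, DifferentiableOn ℂ f disc) {B : ℝ} (hB : 0 ≤ B)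
    (hblock : ∀ f ∈ S, ∀ n : ℕ, ∑ k ∈ Finset.Ico (2 ^ n) (2 ^ (n + 1)),
      ‖coeff f k‖ ^ p * ((k : ℝ) + 1) ^ (p - 1) ≤ B * maxModulus (dyad (n + 2)) f ^ p) :
    ComparableOn S (J p ω) (coeffSum p ω) := by
  obtain ⟨C, hC, h⟩ := hω.exists_J_le hp
  exact ⟨exists_nnreal_pos_of_ne_top ⟨C, hC, fun f hf => h f (hS f hf)⟩,
    exists_nnreal_pos_of_ne_top (hω.exists_coeffSum_le hp hS hB hblock)⟩

end ConformalWeights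

end

theorem theorem7 (ω : ℂ → ℝ) (hω : ConformalWeights.IsDoublingWeight ω) (p : ℝ) (hp : 1 ≤ p) :
    (p ≤ 2 →
      ConformalWeights.ComparableOn ConformalWeights.Univalent
        (ConformalWeights.J p ω) (ConformalWeights.coeffSum p ω)) ∧
    ConformalWeights.ComparableOn ConformalWeights.CloseToConvex
      (ConformalWeights.J p ω) (ConformalWeights.coeffSum p ω) :=
  ⟨fun hp2 => hω.comparableOn hp (fun _ hf => hf.1) (by norm_num)
      fun _ hf n => ConformalWeights.univalent_sum_block_le hp hp2 hf n,
    hω.comparableOn hp (fun _ hf => hf.1) (by positivity)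
      fun _ hf n => ConformalWeights.closeToConvex_sum_block_le hp hf n⟩
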